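/- Let $k,t,m,s\ge 1$, $c\ge 2$ and $n$ be integers. A $\Pi_k\Sigma_c\Pi_t$ polynomial in the variables $x_1,\dots,x_n$ is one given as a product $p_1=f_1\cdots f_k$ of $k$ clauses, where each clause is a sum of at least one and at most $c$ terms and each term is a product of variables, with repetitions allowed, of degree at most $t$. A $\Pi_m\Sigma_s$ polynomial is one given as a product $p_2=g_1\cdots g_m$ of $m$ clauses, each of which is a sum of at least one and at most $s$ single variables. The sum-product expansion of $p=p_1p_2$ is the list of all products obtained by choosing one term from every clause of $p_1$ and of $p_2$, without collecting equal products; a monomial is multilinear if no variable has exponent greater than $1$ in it. There is an algorithm that, given any such pair $p_1,p_2$ in factored form (as lists of clauses, terms and variable indices), decides whether $p=p_1p_2$ has a multilinear monomial in its sum-product expansion (equivalently, whether some multilinear monomial has a non-zero coefficient in $p$ as an element of $\mathbb{Z}[x_1,\dots,x_n]$), and that runs in time $$O\bigl(t\,c^k\,m\,s\,\sqrt{m+n}\bigr),$$ with an absolute constant. Time is the number of steps of a random access machine with addition, subtraction, comparison and indexed memory access at unit cost, whose words have $O(\log N)$ bits, where $N$ is the length of the input plus $n$. -/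

import Mathlib

namespace MonomialTesting

/-! ### Polynomials in factored form

A term is a product of variables, written as the list of its factors (a variable may be repeated),
so that the degree of a term is the length of the list. A clause is a sum of terms, and a
`ΠΣΠ` polynomial is a product of clauses; in a `ΠΣ` polynomial every term is a single variable. -/

/-- A product of sums of products of variables among `x_1, …, x_n`. -/
abbrev PiSigmaPi (n : ℕ) : Type := List (List (List (Fin n)))

/-- A product of sums of variables among `x_1, …, x_n`. -/
abbrev PiSigma (n : ℕ) : Type := List (List (Fin n))

/-- `f` is a `Π_k Σ_c Π_t` polynomial: it has `k` clauses, every clause has at least one and at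
most `c` terms, and every term has degree at most `t`. -/
def IsPiSigmaPi {n : ℕ} (k c t : ℕ) (f : PiSigmaPi n) : Prop :=
  f.length = k ∧ ∀ F ∈ f, 1 ≤ F.length ∧ F.length ≤ c ∧ ∀ X ∈ F, X.length ≤ t

/-- `g` is a `Π_m Σ_s` polynomial: it has `m` clauses, each of them a sum of at least one and at
most `s` variables. -/
def IsPiSigma {n : ℕ} (m s : ℕ) (g : PiSigma n) : Prop :=
  g.length = m ∧ ∀ G ∈ g, 1 ≤ G.length ∧ G.length ≤ s

/-- A `ΠΣ` polynomial seen as a `ΠΣΠ` polynomial whose terms have degree one. -/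
def PiSigma.toPiSigmaPi {n : ℕ} (g : PiSigma n) : PiSigmaPi n :=
  g.map fun G => G.map fun x => [x]

/-- The polynomial over `R` that the factored form represents. -/
noncomputable def PiSigmaPi.toPoly {n : ℕ} (R : Type*) [CommSemiring R] (f : PiSigmaPi n) :
    MvPolynomial (Fin n) R :=
  (f.map fun F => (F.map fun X => (X.map fun x => MvPolynomial.X x).prod).sum).prod

/-- The exponent vector of a term. -/
noncomputable def termMonomial {n : ℕ} (X : List (Fin n)) : Fin n →₀ ℕ :=
  (X.map fun x => Finsupp.single x 1).sum

/-- The sum-product expansion: the list of all products of one term from every clause, as exponent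
vectors. Equal products are not collected. -/
noncomputable def sumProductExpansion {n : ℕ} : PiSigmaPi n → List (Fin n →₀ ℕ)
  | [] => [0]
  | F :: f => F.flatMap fun X => (sumProductExpansion f).map fun d => termMonomial X + d

/-- A monomial is multilinear if no variable has an exponent above one. -/
def IsMultilinear {n : ℕ} (d : Fin n →₀ ℕ) : Prop := ∀ i, d i ≤ 1

theorem monomial_termMonomial {n : ℕ} (R : Type*) [CommSemiring R] (X : List (Fin n)) :
    MvPolynomial.monomial (termMonomial X) (1 : R)
      = (X.map fun x => (MvPolynomial.X x : MvPolynomial (Fin n) R)).prod := by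
  induction X with
  | nil => simp [termMonomial]
  | cons x X ih =>
    simp only [List.map_cons, List.prod_cons, ← ih]
    simp [termMonomial, MvPolynomial.X, MvPolynomial.monomial_mul]

/-- The polynomial is the sum of the monomials in its sum-product expansion. -/
theorem sum_sumProductExpansion {n : ℕ} (R : Type*) [CommSemiring R] (f : PiSigmaPi n) :
    ((sumProductExpansion f).map fun d => MvPolynomial.monomial d (1 : R)).sum = f.toPoly R := by
  induction f with
  | nil => simp [sumProductExpansion, PiSigmaPi.toPoly]
  | cons F f ih =>
    have h : PiSigmaPi.toPoly R (F :: f) =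
        (F.map fun X => (X.map fun x => (MvPolynomial.X x : MvPolynomial (Fin n) R)).prod).sum
          * PiSigmaPi.toPoly R f := by
      simp [PiSigmaPi.toPoly]
    rw [h, ← ih]
    simp only [sumProductExpansion]
    induction F with
    | nil => simp
    | cons X F ihF =>
      have ihF' := ihF (by simp [PiSigmaPi.toPoly])
      simp only [List.flatMap_cons, List.map_append, List.sum_append, List.map_cons,
        List.sum_cons, add_mul, ihF']
      congr 1
      rw [← monomial_termMonomial, ← List.sum_map_mul_left]
      simp [Function.comp_def, MvPolynomial.monomial_mul]

/-! ### A word random access machine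

Programs are structured programs over finitely many registers and finitely many random access
arrays (a program names them by numerals). All of them hold natural numbers, and array indices are
register contents. Every elementary instruction and every test takes one step. -/

/-- Programs. `add r a b`, `sub r a b`: register `r` gets the sum, the truncated difference, of
registers `a` and `b`. `load r A i`: register `r` gets the entry of array `A` whose index is in
register `i`. `store A i r`: that entry gets the content of register `r`. `ite a b p q` and
`loop a b p` test whether the content of register `a` is less than that of register `b`; the latter
repeats `p` while this is so. -/
inductive Program : Type
  | skip : Program
  | const (r v : ℕ) : Program
  | add (r a b : ℕ) : Program
  | sub (r a b : ℕ) : Program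
  | load (r A i : ℕ) : Program
  | store (A i r : ℕ) : Program
  | seq (p q : Program) : Program
  | ite (a b : ℕ) (p q : Program) : Program
  | loop (a b : ℕ) (p : Program) : Program

/-- The contents of the registers and of the arrays. -/
structure Memory : Type where
  reg : ℕ → ℕ
  arr : ℕ → ℕ → ℕ

/-- Register `r` gets the value `v`. -/
def Memory.setReg (M : Memory) (r v : ℕ) : Memory :=
  { M with reg := Function.update M.reg r v }

/-- Entry `i` of array `A` gets the value `v`. -/
def Memory.setArr (M : Memory) (A i v : ℕ) : Memory :=
  { M with arr := Function.update M.arr A (Function.update (M.arr A) i v) }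

/-- `Run W p M M' T`: started in memory `M`, the program `p` halts in memory `M'` after exactly `T`
steps, and no instruction produces a number above `W` (a program that would do so is stuck), so
that words of `O(log W)` bits suffice. -/
inductive Run (W : ℕ) : Program → Memory → Memory → ℕ → Prop
  | skip (M : Memory) : Run W .skip M M 1
  | const (M : Memory) (r v : ℕ) (h : v ≤ W) : Run W (.const r v) M (M.setReg r v) 1
  | add (M : Memory) (r a b : ℕ) (h : M.reg a + M.reg b ≤ W) :
      Run W (.add r a b) M (M.setReg r (M.reg a + M.reg b)) 1
  | sub (M : Memory) (r a b : ℕ) :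
      Run W (.sub r a b) M (M.setReg r (M.reg a - M.reg b)) 1
  | load (M : Memory) (r A i : ℕ) :
      Run W (.load r A i) M (M.setReg r (M.arr A (M.reg i))) 1
  | store (M : Memory) (A i r : ℕ) :
      Run W (.store A i r) M (M.setArr A (M.reg i) (M.reg r)) 1
  | seq {p q : Program} {M₁ M₂ M₃ : Memory} {T₁ T₂ : ℕ}
      (h₁ : Run W p M₁ M₂ T₁) (h₂ : Run W q M₂ M₃ T₂) : Run W (.seq p q) M₁ M₃ (T₁ + T₂)
  | ite_true {a b : ℕ} {p q : Program} {M M' : Memory} {T : ℕ}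
      (h : M.reg a < M.reg b) (hp : Run W p M M' T) : Run W (.ite a b p q) M M' (T + 1)
  | ite_false {a b : ℕ} {p q : Program} {M M' : Memory} {T : ℕ}
      (h : ¬ M.reg a < M.reg b) (hq : Run W q M M' T) : Run W (.ite a b p q) M M' (T + 1)
  | loop_true {a b : ℕ} {p : Program} {M₁ M₂ M₃ : Memory} {T₁ T₂ : ℕ}
      (h : M₁.reg a < M₁.reg b) (hp : Run W p M₁ M₂ T₁)
      (hl : Run W (.loop a b p) M₂ M₃ T₂) : Run W (.loop a b p) M₁ M₃ (T₁ + T₂ + 1)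
  | loop_false {a b : ℕ} {p : Program} {M : Memory}
      (h : ¬ M.reg a < M.reg b) : Run W (.loop a b p) M M 1

/-- The machine is deterministic: the final memory and the number of steps are determined. -/
theorem Run.deterministic {W : ℕ} {p : Program} {M M₁ M₂ : Memory} {T₁ T₂ : ℕ}
    (h₁ : Run W p M M₁ T₁) (h₂ : Run W p M M₂ T₂) : M₁ = M₂ ∧ T₁ = T₂ := by
  induction h₁ generalizing M₂ T₂ with
  | skip => cases h₂; exact ⟨rfl, rfl⟩
  | const => cases h₂; exact ⟨rfl, rfl⟩
  | add => cases h₂; exact ⟨rfl, rfl⟩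
  | sub => cases h₂; exact ⟨rfl, rfl⟩
  | load => cases h₂; exact ⟨rfl, rfl⟩
  | store => cases h₂; exact ⟨rfl, rfl⟩
  | seq _ _ ih₁ ih₂ =>
    cases h₂ with
    | seq h h' =>
      obtain ⟨rfl, rfl⟩ := ih₁ h
      obtain ⟨rfl, rfl⟩ := ih₂ h'
      exact ⟨rfl, rfl⟩
  | ite_true h _ ih =>
    cases h₂ with
    | ite_true _ h' =>
      obtain ⟨rfl, rfl⟩ := ih h'
      exact ⟨rfl, rfl⟩
    | ite_false h' _ => exact absurd h h'
  | ite_false h _ ih =>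
    cases h₂ with
    | ite_true h' _ => exact absurd h' h
    | ite_false _ h' =>
      obtain ⟨rfl, rfl⟩ := ih h'
      exact ⟨rfl, rfl⟩
  | loop_true h _ _ ih₁ ih₂ =>
    cases h₂ with
    | loop_true _ hp hl =>
      obtain ⟨rfl, rfl⟩ := ih₁ hp
      obtain ⟨rfl, rfl⟩ := ih₂ hl
      exact ⟨rfl, rfl⟩
    | loop_false h' => exact absurd h h'
  | loop_false h =>
    cases h₂ with
    | loop_true h' _ _ => exact absurd h' h
    | loop_false _ => exact ⟨rfl, rfl⟩

/-! ### Input and output -/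

/-- A list of variables: its length, followed by the indices of the variables. -/
def encodeVars {n : ℕ} (X : List (Fin n)) : List ℕ := X.length :: X.map fun x => (x : ℕ)

/-- The input word of the pair `f`, `g`: the number `n` of variables; the number of clauses of `f`
and, for every clause, its number of terms followed by these terms; the number of clauses of `g`,
followed by these clauses. -/
def encodeInput {n : ℕ} (f : PiSigmaPi n) (g : PiSigma n) : List ℕ :=
  n :: f.length :: (f.flatMap fun F => F.length :: F.flatMap encodeVars) ++
    g.length :: g.flatMap encodeVars

/-- The initial memory: the input is in array `0`, and everything else is zero. -/
def initialMemory (w : List ℕ) : Memory where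
  reg := fun _ => 0
  arr := fun A i => if A = 0 then w.getD i 0 else 0

/-- The size parameter for the word length: the length of the input word plus the number of
variables. Every number in the input word is at most this large. -/
def inputSize {n : ℕ} (f : PiSigmaPi n) (g : PiSigma n) : ℕ := (encodeInput f g).length + n

end MonomialTesting

open MonomialTesting

/-!
A program that decides whether a product of a `ΠΣΠ` and a `ΠΣ` polynomial has a multilinear
monomial. It goes through the choices of terms from the clauses of the first factor by depth first
search, and drops a partial choice as soon as a variable repeats. For every complete choice it
decides whether distinct new variables can be chosen from the clauses of the second factor: an
auction with about `√m` prices leaves at most `√m` clauses without a variable if this is possible,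
and these are then served one by one along augmenting paths.
-/

namespace MonomialTesting

/-! ### Reasoning about runs -/

/-! A multilinear product exists exactly when terms can be chosen from the clauses of the first
factor without repeating a variable, and distinct further variables can then be chosen from the
clauses of the second factor (`choosable_iff`). All coefficients of the expansion are positive, so
nothing cancels over the integers (`mem_support_iff`). There are at most `c ^ k` choices of terms,
so it suffices to spend O(t) on every node of the search tree and O(m s √m) on every leaf.

A leaf is a bipartite matching problem between clauses and variables. Let `L` be √m rounded up. In
the auction, an unassigned clause takes a variable whose price equals its own level, which raises
the price by one and displaces the former holder. A clause without such a variable raises its level,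
and gives up at level `L`. Every clause scans its list at most `L` times, so this takes O(L · size)
steps. If all clauses can be satisfied, comparing levels with prices along a satisfying choice gives
`L * g ≤ m` for the number `g` of clauses that gave up (`Auction.mul_le`), hence `g ≤ L`. Each of
these is then served by a depth first search for an augmenting path in O(size) steps. A failed
search exhibits a set of clauses with too few variables (`Search.not_saturable`). `ends_saturate`
combines the two phases.

The choices of terms are explored by a single loop that simulates the recursion; `reach_terms` and
`reach_clauses` show that it returns with the multiplicities restored and within the time of the
recursive cost function. As `c ≥ 2`, the costs of the inner nodes form a geometric sum dominated by
the leaves (`exploreCost_le`).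

The number `n` of variables may far exceed the allowed time, so no array indexed by variables is
ever cleared as a whole. Only variables that occur in the clauses are reset, which is why matchings
and prices are constrained only on such variables. -/

/-- Started in `M`, the program `p` halts without exceeding `W`, and the final memory and the number
of steps satisfy `Q`. -/
def Ends (W : ℕ) (p : Program) (M : Memory) (Q : Memory → ℕ → Prop) : Prop :=
  ∃ M' T, Run W p M M' T ∧ Q M' T

section Ends

variable {W : ℕ} {p q : Program} {M : Memory} {Q R : Memory → ℕ → Prop} {r a b A i v : ℕ}

theorem Ends.mono (h : Ends W p M Q) (hQ : ∀ M' T, Q M' T → R M' T) : Ends W p M R := by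
  obtain ⟨M', T, h, hq⟩ := h
  exact ⟨M', T, h, hQ _ _ hq⟩

@[simp] theorem ends_skip : Ends W .skip M Q ↔ Q M 1 :=
  ⟨fun ⟨_, _, h, hQ⟩ => by cases h; exact hQ, fun h => ⟨_, _, .skip M, h⟩⟩

@[simp] theorem ends_const : Ends W (.const r v) M Q ↔ v ≤ W ∧ Q (M.setReg r v) 1 :=
  ⟨fun ⟨_, _, h, hQ⟩ => by cases h with | const _ _ _ h => exact ⟨h, hQ⟩,
    fun h => ⟨_, _, .const M r v h.1, h.2⟩⟩

@[simp] theorem ends_add : Ends W (.add r a b) M Q ↔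
    M.reg a + M.reg b ≤ W ∧ Q (M.setReg r (M.reg a + M.reg b)) 1 :=
  ⟨fun ⟨_, _, h, hQ⟩ => by cases h with | add _ _ _ _ h => exact ⟨h, hQ⟩,
    fun h => ⟨_, _, .add M r a b h.1, h.2⟩⟩

@[simp] theorem ends_sub : Ends W (.sub r a b) M Q ↔ Q (M.setReg r (M.reg a - M.reg b)) 1 :=
  ⟨fun ⟨_, _, h, hQ⟩ => by cases h; exact hQ, fun h => ⟨_, _, .sub M r a b, h⟩⟩

@[simp] theorem ends_load : Ends W (.load r A i) M Q ↔ Q (M.setReg r (M.arr A (M.reg i))) 1 :=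
  ⟨fun ⟨_, _, h, hQ⟩ => by cases h; exact hQ, fun h => ⟨_, _, .load M r A i, h⟩⟩

@[simp] theorem ends_store :
    Ends W (.store A i r) M Q ↔ Q (M.setArr A (M.reg i) (M.reg r)) 1 :=
  ⟨fun ⟨_, _, h, hQ⟩ => by cases h; exact hQ, fun h => ⟨_, _, .store M A i r, h⟩⟩

theorem ends_seq : Ends W (.seq p q) M Q ↔
    Ends W p M fun M₁ T₁ => Ends W q M₁ fun M₂ T₂ => Q M₂ (T₁ + T₂) := by
  constructor
  · rintro ⟨_, _, h, hQ⟩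
    cases h with
    | seq h₁ h₂ => exact ⟨_, _, h₁, _, _, h₂, hQ⟩
  · rintro ⟨_, _, h₁, _, _, h₂, hQ⟩
    exact ⟨_, _, .seq h₁ h₂, hQ⟩

theorem ends_ite : Ends W (.ite a b p q) M Q ↔
    (M.reg a < M.reg b → Ends W p M fun M' T => Q M' (T + 1)) ∧
      (M.reg b ≤ M.reg a → Ends W q M fun M' T => Q M' (T + 1)) := by
  constructor
  · rintro ⟨_, _, h, hQ⟩
    cases h with
    | ite_true h hp => exact ⟨fun _ => ⟨_, _, hp, hQ⟩, fun h' => absurd h h'.not_gt⟩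
    | ite_false h hp => exact ⟨fun h' => absurd h' h, fun _ => ⟨_, _, hp, hQ⟩⟩
  · rintro ⟨h₁, h₂⟩
    by_cases h : M.reg a < M.reg b
    · obtain ⟨_, _, hp, hQ⟩ := h₁ h
      exact ⟨_, _, .ite_true h hp, hQ⟩
    · obtain ⟨_, _, hp, hQ⟩ := h₂ (not_lt.1 h)
      exact ⟨_, _, .ite_false h hp, hQ⟩

theorem ends_loop_of_lt (h : M.reg a < M.reg b)
    (hp : Ends W p M fun M₁ T₁ => Ends W (.loop a b p) M₁ fun M₂ T₂ => Q M₂ (T₁ + T₂ + 1)) :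
    Ends W (.loop a b p) M Q := by
  obtain ⟨_, _, h₁, _, _, h₂, hQ⟩ := hp
  exact ⟨_, _, .loop_true h h₁ h₂, hQ⟩

theorem ends_loop_of_le (h : M.reg b ≤ M.reg a) (hQ : Q M 1) : Ends W (.loop a b p) M Q :=
  ⟨_, _, .loop_false h.not_gt, hQ⟩

/-- The loop rule. The first argument of the invariant bounds the time that is left, except for the
last test. -/
theorem ends_loop (Inv : ℕ → Memory → Prop) {B : ℕ} (h₀ : Inv B M)
    (hstep : ∀ B M, Inv B M → M.reg a < M.reg b →
      Ends W p M fun M' T => ∃ B', Inv B' M' ∧ T + 1 + B' ≤ B)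
    (hend : ∀ B' M' T, Inv B' M' → M'.reg b ≤ M'.reg a → T + B' ≤ B + 1 → Q M' T) :
    Ends W (.loop a b p) M Q := by
  induction B using Nat.strong_induction_on generalizing M Q with
  | _ B ih =>
    rcases lt_or_ge (M.reg a) (M.reg b) with h | h
    · refine ends_loop_of_lt h ((hstep B M h₀ h).mono ?_)
      rintro M₁ T₁ ⟨B', hI, hB⟩
      exact ih B' (by omega) hI fun B'' M' T h₁ h₂ h₃ => hend B'' M' _ h₁ h₂ (by omega)
    · exact ends_loop_of_le h (hend B M 1 h₀ h (by omega))

end Ends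

/-! ### Memory updates and frame conditions -/

section Memory

variable {M M₀ : Memory} {r s v A B i : ℕ}

@[simp] theorem Memory.reg_setReg : (M.setReg r v).reg s = if s = r then v else M.reg s := by
  simp [Memory.setReg, Function.update_apply]

@[simp] theorem Memory.arr_setReg : (M.setReg r v).arr = M.arr := rfl

@[simp] theorem Memory.reg_setArr : (M.setArr A i v).reg = M.reg := rfl

@[simp] theorem Memory.arr_setArr :
    (M.setArr A i v).arr B = if B = A then Function.update (M.arr A) i v else M.arr B := by
  simp [Memory.setArr, Function.update_apply]

/-- The memories `M₀` and `M` agree on the registers below `ρ` and the arrays below `α`. -/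
def Agree (ρ α : ℕ) (M₀ M : Memory) : Prop :=
  (∀ r < ρ, M.reg r = M₀.reg r) ∧ ∀ A < α, M.arr A = M₀.arr A

variable {ρ α : ℕ}

theorem Agree.refl (M : Memory) : Agree ρ α M M := ⟨fun _ _ => rfl, fun _ _ => rfl⟩

theorem Agree.trans {M₁ M₂ : Memory} (h : Agree ρ α M M₁) (h' : Agree ρ α M₁ M₂) :
    Agree ρ α M M₂ :=
  ⟨fun r hr => (h'.1 r hr).trans (h.1 r hr), fun A hA => (h'.2 A hA).trans (h.2 A hA)⟩

theorem Agree.setReg (h : Agree ρ α M₀ M) (hr : ρ ≤ r) : Agree ρ α M₀ (M.setReg r v) :=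
  ⟨fun s hs => by simpa [show s ≠ r by omega] using h.1 s hs, h.2⟩

theorem Agree.setArr (h : Agree ρ α M₀ M) (hA : α ≤ A) : Agree ρ α M₀ (M.setArr A i v) :=
  ⟨h.1, fun B hB => by simpa [show B ≠ A by omega] using h.2 B hB⟩

end Memory

/-! ### Matching clauses to variables -/

/-- A product of `m` clauses in factored form. The variables of clause `u` are the entries of `var`
at the positions from `st u` to `en u`, and the variables at which `used` is positive are
forbidden. -/
structure Incidence where
  m : ℕ
  st : ℕ → ℕ
  en : ℕ → ℕ
  var : ℕ → ℕ
  used : ℕ → ℕ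

namespace Incidence

variable (G : Incidence)

/-- Variable `v` occurs in clause `u`. -/
def Adj (u v : ℕ) : Prop := ∃ p, G.st u ≤ p ∧ p < G.en u ∧ G.var p = v

/-- Variable `v` occurs in some clause. -/
def Occurs (v : ℕ) : Prop := ∃ u < G.m, G.Adj u v

/-- One can choose distinct variables from the clauses, none of them forbidden. -/
def Saturable : Prop :=
  ∃ σ : ℕ → ℕ, (∀ u < G.m, G.Adj u (σ u) ∧ G.used (σ u) = 0) ∧ Set.InjOn σ (Set.Iio G.m)

/-- In the partial assignment `mV`, variable `v` is assigned to clause `u`. -/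
def Mate (mV : ℕ → ℕ) (v u : ℕ) : Prop := G.Occurs v ∧ mV v = u + 1

/-- The partial assignment `mV` is a matching. -/
structure IsMatching (mV : ℕ → ℕ) : Prop where
  lt : ∀ v u, G.Mate mV v u → u < G.m
  adj : ∀ v u, G.Mate mV v u → G.Adj u v
  unused : ∀ v u, G.Mate mV v u → G.used v = 0
  inj : ∀ v v' u, G.Mate mV v u → G.Mate mV v' u → v = v'

variable {G} {mV : ℕ → ℕ} {u v w c : ℕ}

theorem Adj.occurs (h : G.Adj u v) (hu : u < G.m) : G.Occurs v := ⟨u, hu, h⟩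

theorem Mate.right_unique (h : G.Mate mV v u) (h' : G.Mate mV v w) : u = w := by
  have := h.2.symm.trans h'.2; omega

/-- Clauses are stored shifted by one, so that the value `0` stands for a free variable. -/
theorem mate_update (hv : G.Occurs v) {v' : ℕ} :
    G.Mate (Function.update mV v (c + 1)) v' u ↔ v' = v ∧ u = c ∨ v' ≠ v ∧ G.Mate mV v' u := by
  by_cases h : v' = v
  · subst h; simp [Mate, hv, eq_comm]
  · simp [Mate, h]

theorem isMatching_of_eq_zero (h : ∀ v, G.Occurs v → mV v = 0) : G.IsMatching mV := by
  have : ∀ v u, ¬ G.Mate mV v u := fun v u h' => by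
    have h1 := h v h'.1
    have h2 := h'.2
    omega
  constructor <;> intros <;> exact absurd ‹_› (this _ _)

/-- Overwriting the entry of `v` dispossesses its former holder, so injectivity only needs that `c`
holds no other variable. -/
theorem IsMatching.update (h : G.IsMatching mV) (hc : c < G.m) (hv : G.Adj c v)
    (hu : G.used v = 0) (hm : ∀ v', G.Mate mV v' c → v' = v) :
    G.IsMatching (Function.update mV v (c + 1)) := by
  obtain ⟨h1, h2, h3, h4⟩ := h
  have ho := hv.occurs hc
  constructor <;> simp only [mate_update ho] <;> grind

theorem saturable_of_forall_mate (h : G.IsMatching mV) (hm : ∀ u < G.m, ∃ v, G.Mate mV v u) :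
    G.Saturable := by
  choose! σ hσ using hm
  refine ⟨σ, fun u hu => ⟨h.adj _ _ (hσ u hu), h.unused _ _ (hσ u hu)⟩, fun u hu u' hu' e => ?_⟩
  have h1 := hσ u hu
  have h2 := hσ u' hu'
  rw [← e] at h2
  exact h1.right_unique h2

/-! ### The auction -/

/-- The state of the auction: every variable `v` has a price, and a clause `u` bids for its
variables of price `level u`, of which none is left before position `ptr u`. The clauses in `act`
are not yet assigned a variable, and the `g` clauses in the list `gl` have given up at level `L`. -/
structure Auction (G : Incidence) (L : ℕ) (mV price level ptr gl : ℕ → ℕ) (g : ℕ)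
    (act : ℕ → Prop) : Prop where
  matching : G.IsMatching mV
  price_mate : ∀ v u, G.Mate mV v u → price v = level u + 1
  price_le : ∀ v, G.Occurs v → price v ≤ L
  price_free : ∀ v, G.Occurs v → G.used v = 0 → mV v = 0 → price v = 0
  price_used : ∀ v, G.Occurs v → G.used v ≠ 0 → price v = L
  low : ∀ u < G.m, ∀ v, G.Adj u v → level u ≤ price v
  passed : ∀ u < G.m, ∀ p, G.st u ≤ p → p < ptr u → level u < price (G.var p)
  st_le : ∀ u < G.m, G.st u ≤ ptr u
  le_en : ∀ u < G.m, ptr u ≤ G.en u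
  act_lt : ∀ u, act u → u < G.m
  act_level : ∀ u, act u → level u < L
  act_free : ∀ u v, act u → ¬ G.Mate mV v u
  given_lt : ∀ i < g, gl i < G.m
  given_level : ∀ i < g, level (gl i) = L
  given_inj : ∀ i < g, ∀ j < g, gl i = gl j → i = j
  cover : ∀ u < G.m, act u ∨ (∃ v, G.Mate mV v u) ∨ ∃ i < g, gl i = u

namespace Auction

variable {L g : ℕ} {price level ptr gl : ℕ → ℕ} {act : ℕ → Prop}

/-- Forbidden variables start at the price `L`, which no active clause can afford, since its level
is below `L`. -/
theorem init (hL : 0 < L) (hst : ∀ u < G.m, G.st u ≤ G.en u)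
    (hm : ∀ v, G.Occurs v → mV v = 0)
    (hp : ∀ v, G.Occurs v → price v = if G.used v = 0 then 0 else L)
    (hl : ∀ u < G.m, level u = 0) (hptr : ∀ u < G.m, ptr u = G.st u) :
    G.Auction L mV price level ptr gl 0 fun u => u < G.m := by
  have hM := isMatching_of_eq_zero hm
  have hn : ∀ v u, ¬ G.Mate mV v u := fun v u h' => by have := h'.2; simp [hm v h'.1] at this
  constructor <;> grind

theorem skip (h : G.Auction L mV price level ptr gl g act) (hc : act c) (hp : ptr c < G.en c)
    (hv : level c < price (G.var (ptr c))) :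
    G.Auction L mV price level (Function.update ptr c (ptr c + 1)) gl g act := by
  obtain ⟨h1, h2, h3, h4, h5, h6, h7, h8, h9, h10, h11, h12, h13, h14, h15, h16⟩ := h
  constructor <;> try assumption
  all_goals
    intro u hu
    have := h7 u hu
    have := h8 u hu
    have := h9 u hu
    grind [Function.update_apply]

/-- By `low`, the price of the variable is exactly the level of `c`, so the purchase raises it by
one. Prices never fall, which preserves `low` and `passed`. The former holder, if there is one,
becomes active in place of `c`. -/
theorem take (h : G.Auction L mV price level ptr gl g act) (hc : act c) (hp : ptr c < G.en c)
    (hv : price (G.var (ptr c)) ≤ level c) :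
    G.Auction L (Function.update mV (G.var (ptr c)) (c + 1))
      (Function.update price (G.var (ptr c)) (level c + 1)) level
      (Function.update ptr c (ptr c + 1)) gl g
      fun u => act u ∧ u ≠ c ∨ mV (G.var (ptr c)) = u + 1 := by
  obtain ⟨h1, h2, h3, h4, h5, h6, h7, h8, h9, h10, h11, h12, h13, h14, h15, h16⟩ := h
  have hcm := h10 c hc
  have ha : G.Adj c (G.var (ptr c)) := ⟨ptr c, h8 c hcm, hp, rfl⟩
  generalize hvv : G.var (ptr c) = v at *
  have ho := ha.occurs hcm
  have hlev : price v = level c := le_antisymm hv (h6 c hcm v ha)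
  have hu : G.used v = 0 := by
    by_contra h
    have := h5 v ho h; have := h11 c hc; omega
  have hw : ∀ w, mV v = w + 1 → G.Mate mV v w := fun w hw => ⟨ho, hw⟩
  constructor
  · exact h1.update hcm ha hu fun v' h' => absurd h' (h12 _ _ hc)
  all_goals try simp only [mate_update ho]
  · grind
  · grind
  · grind
  · grind
  · grind
  · intro u hu p hp1 hp2
    have := h7 u hu p hp1
    grind
  · grind
  · grind
  · rintro u (⟨hu, -⟩ | hu)
    · exact h10 u hu
    · exact h1.lt _ _ (hw u hu)
  · rintro u (⟨hu, -⟩ | hu)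
    · exact h11 u hu
    -- The displaced clause is one level below the price it paid, and that price is the level of
    -- `c`, which is below `L`.
    · have := h2 _ _ (hw u hu)
      have := h11 c hc
      omega
  · rintro u x (⟨hu, huc⟩ | hu) (⟨hx, hxu⟩ | ⟨hx, hxu⟩)
    · exact huc hxu
    · exact h12 _ _ hu hxu
    · exact h12 _ _ hc (hxu ▸ hw u hu)
    · exact hx (h1.inj _ _ _ hxu (hw u hu))
  · grind
  · grind
  · grind
  · intro u hu
    rcases h16 u hu with h | ⟨x, hx⟩ | h
    · grind
    · by_cases hxv : x = v
      · subst hxv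
        exact .inl (.inr hx.2)
      · exact .inr (.inl ⟨x, .inr ⟨hxv, hx⟩⟩)
    · grind

theorem lt_price (h : G.Auction L mV price level ptr gl g act) (hc : c < G.m)
    (hp : ptr c = G.en c) (hv : G.Adj c v) : level c < price v := by
  obtain ⟨p, h1, h2, rfl⟩ := hv
  exact h.passed c hc p h1 (by omega)

/-- Once the list of `c` is exhausted, all its variables cost more than its level, so raising the
level by one keeps `low`. -/
theorem raise (h : G.Auction L mV price level ptr gl g act) (hc : act c) (hp : ptr c = G.en c)
    (hL : level c + 1 < L) :
    G.Auction L mV price (Function.update level c (level c + 1))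
      (Function.update ptr c (G.st c)) gl g act := by
  have hlt := fun v => h.lt_price (v := v) (h.act_lt c hc) hp
  obtain ⟨h1, h2, h3, h4, h5, h6, h7, h8, h9, h10, h11, h12, h13, h14, h15, h16⟩ := h
  have := h8 c (h10 c hc)
  constructor <;> try assumption
  · grind
  · grind
  · intro u hu p hp1 hp2; have := h7 u hu p hp1; grind
  all_goals grind

theorem giveUp (h : G.Auction L mV price level ptr gl g act) (hc : act c) (hp : ptr c = G.en c)
    (hL : level c + 1 = L) :
    G.Auction L mV price (Function.update level c (level c + 1))
      (Function.update ptr c (G.st c)) (Function.update gl g c) (g + 1)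
      fun u => act u ∧ u ≠ c := by
  have hlt := fun v => h.lt_price (v := v) (h.act_lt c hc) hp
  obtain ⟨h1, h2, h3, h4, h5, h6, h7, h8, h9, h10, h11, h12, h13, h14, h15, h16⟩ := h
  have := h8 c (h10 c hc)
  constructor <;> try assumption
  · grind
  · grind
  · intro u hu p hp1 hp2; have := h7 u hu p hp1; grind
  · grind
  · grind
  · grind
  · grind
  · grind
  · grind
  · grind
  -- The new entry `c` differs from the earlier ones because its level was below `L` until now.
  · intro i hi j hj; have := h11 c hc; have := h14 i; have := h14 j; have := h15 i; grind
  · intro u hu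
    rcases h16 u hu with h | h | ⟨i, hi, rfl⟩
    · by_cases huc : u = c
      · exact .inr (.inr ⟨g, by omega, by simp [huc]⟩)
      · exact .inl ⟨h, huc⟩
    · exact .inr (.inl h)
    · exact .inr (.inr ⟨i, by omega, by simp [hi.ne]⟩)

/-- A variable held by a clause of level `L` would have the price `L + 1`, above the cap. -/
theorem given_free (h : G.Auction L mV price level ptr gl g act) {i : ℕ} (hi : i < g) :
    ¬ G.Mate mV v (gl i) := by
  intro hv
  have := h.price_mate _ _ hv
  have := h.price_le _ hv.1
  have := h.given_level i hi
  omega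

/-- Keeps the counter of the clauses that have given up within a machine word. -/
theorem given_le (h : G.Auction L mV price level ptr gl g act) : g ≤ G.m := by
  simpa using Finset.card_le_card_of_injOn (s := Finset.range g) (t := Finset.range G.m) gl
    (fun i hi => Finset.mem_coe.2 (Finset.mem_range.2 (h.given_lt i (by simpa using hi))))
    fun i hi j hj => h.given_inj i (by simpa using hi) j (by simpa using hj)

open Finset in
/-- When the auction is over, few clauses have given up if all clauses can be satisfied. -/
theorem mul_le (h : G.Auction L mV price level ptr gl g fun _ => False) (hG : G.Saturable) :
    L * g ≤ G.m := by
  classical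
  obtain ⟨σ, hσ, hinj⟩ := hG
  set U := range G.m
  set A := U.filter fun u => ∃ v, G.Mate mV v u
  set B := U.filter fun u => mV (σ u) ≠ 0
  have hocc : ∀ u ∈ U, G.Occurs (σ u) :=
    fun u hu => (hσ u (mem_range.1 hu)).1.occurs (mem_range.1 hu)
  have hmate : ∀ u ∈ B, G.Mate mV (σ u) (mV (σ u) - 1) := fun u hu =>
    ⟨hocc u (mem_filter.1 hu).1, by have := (mem_filter.1 hu).2; omega⟩
  -- The sum of all levels is estimated twice. Along the satisfying choice `σ` it is at most a sum
  -- of prices, which in turn is at most the sum of `level u + 1` over the assigned clauses. On the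
  -- other hand it is at least `g * L` plus the levels of the assigned clauses.
  have h1 : ∑ u ∈ U, level u ≤ ∑ u ∈ U, price (σ u) :=
    sum_le_sum fun u hu => h.low u (mem_range.1 hu) _ (hσ u (mem_range.1 hu)).1
  -- Allowed variables that are still free cost nothing.
  have h2 : ∑ u ∈ U, price (σ u) = ∑ u ∈ B, price (σ u) := by
    refine (sum_subset (filter_subset _ _) fun u hu hB => ?_).symm
    refine h.price_free _ (hocc u hu) (hσ u (mem_range.1 hu)).2 ?_
    by_contra h0
    exact hB (mem_filter.2 ⟨hu, h0⟩)
  -- Each remaining variable costs one more than the level of its holder, and distinct variables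
  -- have distinct holders.
  have h3 : ∑ u ∈ B, price (σ u) = ∑ u ∈ B.image fun u => mV (σ u) - 1, (level u + 1) := by
    rw [sum_image]
    · exact sum_congr rfl fun u hu => h.price_mate _ _ (hmate u hu)
    · intro u hu u' hu' e
      have ha := hmate u hu
      have hb := hmate u' hu'
      simp only at e
      rw [← e] at hb
      exact hinj (mem_range.1 (mem_filter.1 hu).1) (mem_range.1 (mem_filter.1 hu').1)
        (h.matching.inj _ _ _ ha hb)
  have h4 : ∑ u ∈ B.image fun u => mV (σ u) - 1, (level u + 1) ≤ ∑ u ∈ A, (level u + 1) := by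
    refine sum_le_sum_of_subset fun w hw => ?_
    obtain ⟨u, hu, rfl⟩ := mem_image.1 hw
    exact mem_filter.2 ⟨mem_range.2 (h.matching.lt _ _ (hmate u hu)), _, hmate u hu⟩
  have h5 : ∑ u ∈ A, (level u + 1) = ∑ u ∈ A, level u + #A := by simp [sum_add_distrib]
  have h6 : #A ≤ G.m := (card_filter_le _ _).trans (by simp [U])
  -- Clauses that have given up hold no variable, so the two index sets are disjoint.
  have h7 : ∑ u ∈ A, level u + ∑ u ∈ (range g).image gl, level u ≤ ∑ u ∈ U, level u := by
    rw [← sum_union]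
    · refine sum_le_sum_of_subset (union_subset (filter_subset _ _) fun w hw => ?_)
      obtain ⟨i, hi, rfl⟩ := mem_image.1 hw
      exact mem_range.2 (h.given_lt i (mem_range.1 hi))
    · refine disjoint_left.2 fun w hw hw' => ?_
      obtain ⟨i, hi, rfl⟩ := mem_image.1 hw'
      obtain ⟨v, hv⟩ := (mem_filter.1 hw).2
      have := h.price_mate _ _ hv
      have := h.price_le _ hv.1
      have := h.given_level i (mem_range.1 hi)
      omega
  have h8 : ∑ u ∈ (range g).image gl, level u = g * L := by
    rw [sum_image fun i hi j hj => h.given_inj i (mem_range.1 hi) j (mem_range.1 hj),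
      sum_congr rfl fun i hi => h.given_level i (mem_range.1 hi)]
    simp
  rw [mul_comm]
  omega

end Auction

/-! ### Potentials -/

/-- The number of words in which the clauses are encoded. -/
def size (G : Incidence) : ℕ := ∑ u ∈ Finset.range G.m, (G.en u - G.st u + 1)

/-- An upper bound for the number of steps that scan the clauses. -/
def potential (G : Incidence) (L : ℕ) (level ptr : ℕ → ℕ) : ℕ :=
  ∑ u ∈ Finset.range G.m, ((L - level u) * (G.en u - G.st u + 1) + (G.en u - ptr u))

theorem sum_range_add_one {m c : ℕ} {f f' : ℕ → ℕ} (hc : c < m) (h : ∀ u ≠ c, f' u = f u)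
    (h' : f' c + 1 = f c) : ∑ u ∈ Finset.range m, f' u + 1 = ∑ u ∈ Finset.range m, f u := by
  have hc := Finset.mem_range.2 hc
  have e : ∑ u ∈ (Finset.range m).erase c, f' u = ∑ u ∈ (Finset.range m).erase c, f u :=
    Finset.sum_congr rfl fun u hu => h u (Finset.ne_of_mem_erase hu)
  rw [← Finset.add_sum_erase _ _ hc, ← Finset.add_sum_erase _ (fun u => f u) hc, ← h', e]
  ring

section Potential

variable {L : ℕ} {level ptr : ℕ → ℕ}

theorem potential_advance (hc : c < G.m) (hp : ptr c < G.en c) :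
    G.potential L level (Function.update ptr c (ptr c + 1)) + 1 = G.potential L level ptr := by
  refine sum_range_add_one hc (fun u hu => by simp [hu]) ?_
  simp only [Function.update_self]
  omega

/-- Raising the level releases the length of the clause plus one; resetting the pointer takes back
the length. The extra unit pays for the step. -/
theorem potential_raise (hc : c < G.m) (hp : ptr c = G.en c) (hL : level c < L) :
    G.potential L (Function.update level c (level c + 1)) (Function.update ptr c (G.st c)) + 1 =
      G.potential L level ptr := by
  refine sum_range_add_one hc (fun u hu => by simp [hu]) ?_
  obtain ⟨d, hd⟩ : ∃ d, L - level c = d + 1 := ⟨L - level c - 1, by omega⟩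
  have hd' : L - (level c + 1) = d := by omega
  simp only [Function.update_self, hd, hd', hp, add_mul]
  omega

theorem potential_le (hp : ∀ u < G.m, ptr u = G.st u) :
    G.potential L level ptr ≤ (L + 1) * G.size := by
  rw [potential, size, Finset.mul_sum]
  refine Finset.sum_le_sum fun u hu => ?_
  rw [hp u (Finset.mem_range.1 hu), add_mul]
  have : (L - level u) * (G.en u - G.st u + 1) ≤ L * (G.en u - G.st u + 1) :=
    Nat.mul_le_mul_right _ (Nat.sub_le _ _)
  omega

theorem le_size : G.m ≤ G.size := by
  have : ∑ u ∈ Finset.range G.m, 1 ≤ G.size := Finset.sum_le_sum fun u _ => by omega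
  simpa using this

end Potential

/-! ### Augmenting a matching -/

/-- The clauses `c :: l` are the stack of a depth first search from `root`. Clause `c` has lost the
variable `frm c` to the next one, and so on. -/
def Path (G : Incidence) (mV frm : ℕ → ℕ) (P : ℕ → Prop) (root : ℕ) : ℕ → List ℕ → Prop
  | c, [] => c = root
  | c, y :: l => G.Mate mV (frm c) y ∧ G.Adj c (frm c) ∧ G.used (frm c) = 0 ∧ P (frm c) ∧
      Path G mV frm P root y l

section Path

variable {frm mV' frm' : ℕ → ℕ} {P P' : ℕ → Prop} {root y : ℕ} {l : List ℕ}

theorem Path.root_mem (h : G.Path mV frm P root c l) : root ∈ c :: l := by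
  induction l generalizing c with
  | nil => simp [show c = root from h]
  | cons y l ih => exact List.mem_cons_of_mem _ (ih h.2.2.2.2)

/-- Clauses below the top of the stack hold visited variables, so the holder of an unvisited one is
not among them. This keeps the stack free of duplicates. -/
theorem Path.exists_mate (h : G.Path mV frm P root c l) (hy : y ∈ l) :
    ∃ x, G.Mate mV x y ∧ P x := by
  induction l generalizing c with
  | nil => simp at hy
  | cons z l ih =>
    rcases List.mem_cons.1 hy with rfl | hy
    · exact ⟨_, h.1, h.2.2.2.1⟩
    · exact ih h.2.2.2.2 hy

theorem Path.congr (h : G.Path mV frm P root c l)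
    (hf : ∀ x ∈ c :: l, frm' x = frm x)
    (hm : ∀ y ∈ l, ∀ x, P x → G.Mate mV x y → G.Mate mV' x y) (hP : ∀ x, P x → P' x) :
    G.Path mV' frm' P' root c l := by
  induction l generalizing c with
  | nil => exact h
  | cons y l ih =>
    obtain ⟨h1, h2, h3, h4, h5⟩ := h
    rw [Path, hf c (by simp)]
    exact ⟨hm y (by simp) _ h4 h1, h2, h3, hP _ h4,
      ih h5 (fun x hx => hf x (List.mem_cons_of_mem _ hx))
        fun y' hy' => hm y' (List.mem_cons_of_mem _ hy')⟩

end Path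

/-- The state of a depth first search from the clause `root`: clause `c` is without a variable and
looks for an unvisited one from position `ptr c` on. -/
structure Search (G : Incidence) (mV₀ : ℕ → ℕ) (root : ℕ) (mV vis ptr frm : ℕ → ℕ) (c : ℕ)
    (l : List ℕ) : Prop where
  matching : G.IsMatching mV
  vis_used : ∀ v, G.Occurs v → G.used v ≠ 0 → vis v ≠ 0
  free : ∀ v, ¬ G.Mate mV v c
  keep : ∀ u, (u = root ∨ ∃ v, G.Mate mV₀ v u) ↔ (u = c ∨ ∃ v, G.Mate mV v u)
  path : G.Path mV frm (fun v => vis v ≠ 0) root c l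
  nodup : (c :: l).Nodup
  lt : ∀ u ∈ c :: l, u < G.m
  closed : ∀ v, G.Occurs v → vis v ≠ 0 → G.used v = 0 →
    ∃ u, G.Mate mV v u ∧ (u ∈ l ∨ ptr u = G.en u)
  passed : ∀ u < G.m, ∀ p, G.st u ≤ p → p < ptr u → vis (G.var p) ≠ 0
  st_le : ∀ u < G.m, G.st u ≤ ptr u
  le_en : ∀ u < G.m, ptr u ≤ G.en u

namespace Search

variable {mV₀ vis ptr frm : ℕ → ℕ} {root : ℕ} {l : List ℕ}

theorem init (h : G.IsMatching mV₀) (hr : root < G.m) (hf : ∀ v, ¬ G.Mate mV₀ v root)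
    (hst : ∀ u < G.m, G.st u ≤ G.en u) (hv : ∀ v, G.Occurs v → (vis v ≠ 0 ↔ G.used v ≠ 0))
    (hp : ∀ u < G.m, ptr u = G.st u) : G.Search mV₀ root mV₀ vis ptr frm root [] := by
  have : G.Path mV₀ frm (fun v => vis v ≠ 0) root root [] := rfl
  constructor <;> grind

theorem skip (h : G.Search mV₀ root mV vis ptr frm c l) (hp : ptr c < G.en c)
    (hv : vis (G.var (ptr c)) ≠ 0) :
    G.Search mV₀ root mV vis (Function.update ptr c (ptr c + 1)) frm c l := by
  obtain ⟨h1, h2, h3, h4, h5, h6, h7, h8, h9, h10, h11⟩ := h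
  constructor <;> try assumption
  · intro v hv h hu
    obtain ⟨u, hm, h⟩ := h8 v hv h hu
    grind
  all_goals intro u hu; have := h9 u hu; have := h10 u hu; have := h11 u hu; grind

theorem isMatching_update (h : G.Search mV₀ root mV vis ptr frm c l) (hp : ptr c < G.en c)
    (hv : vis (G.var (ptr c)) = 0) :
    G.IsMatching (Function.update mV (G.var (ptr c)) (c + 1)) := by
  have hc := h.lt c (by simp)
  have ha : G.Adj c (G.var (ptr c)) := ⟨ptr c, h.st_le c hc, hp, rfl⟩
  refine h.matching.update hc ha ?_ fun v' h' => absurd h' (h.free _)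
  by_contra hu
  exact h.vis_used _ (ha.occurs hc) hu hv

/-- The search finds a variable that is not assigned yet. -/
theorem success (h : G.Search mV₀ root mV vis ptr frm c l) (hp : ptr c < G.en c)
    (h0 : mV (G.var (ptr c)) = 0) (u : ℕ) :
    (u = root ∨ ∃ v, G.Mate mV₀ v u) ↔
      ∃ v, G.Mate (Function.update mV (G.var (ptr c)) (c + 1)) v u := by
  have hc := h.lt c (by simp)
  have ha : G.Adj c (G.var (ptr c)) := ⟨ptr c, h.st_le c hc, hp, rfl⟩
  simp only [mate_update (ha.occurs hc)]
  rw [h.keep u]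
  constructor
  · rintro (rfl | ⟨v, hv⟩)
    · exact ⟨_, .inl ⟨rfl, rfl⟩⟩
    · refine ⟨v, .inr ⟨?_, hv⟩⟩
      rintro rfl
      have := hv.2
      omega
  · rintro ⟨v, ⟨-, rfl⟩ | ⟨-, hv⟩⟩
    · exact .inl rfl
    · exact .inr ⟨v, hv⟩

/-- The clause `c` takes the variable from `w` at once, and `w` searches next. The assignment thus
remains a matching throughout, and success requires no unwinding of the path. -/
theorem forward (h : G.Search mV₀ root mV vis ptr frm c l) (hp : ptr c < G.en c)
    (hv : vis (G.var (ptr c)) = 0) (hw : mV (G.var (ptr c)) = w + 1) :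
    G.Search mV₀ root (Function.update mV (G.var (ptr c)) (c + 1))
      (Function.update vis (G.var (ptr c)) 1) (Function.update ptr c (ptr c + 1))
      (Function.update frm w (G.var (ptr c))) w (c :: l) := by
  have hM := h.isMatching_update hp hv
  obtain ⟨h1, h2, h3, h4, h5, h6, h7, h8, h9, h10, h11⟩ := h
  have hcm := h7 c (by simp)
  have ha : G.Adj c (G.var (ptr c)) := ⟨ptr c, h10 c hcm, hp, rfl⟩
  generalize hvv : G.var (ptr c) = v at *
  have ho := ha.occurs hcm
  have hmw : G.Mate mV v w := ⟨ho, hw⟩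
  have hu : G.used v = 0 := by
    by_contra h
    exact h2 v ho h hv
  have hwc : w ≠ c := by rintro rfl; exact h3 _ hmw
  have hwl : w ∉ c :: l := by
    intro hm
    rcases List.mem_cons.1 hm with rfl | hm
    · exact hwc rfl
    · obtain ⟨x, hx, hx'⟩ := h5.exists_mate hm
      rw [h1.inj _ _ _ hx hmw] at hx'
      exact hx' hv
  constructor
  · exact hM
  · grind
  · intro x
    rw [mate_update ho]
    have := h1.inj x v w
    grind
  · intro u
    simp only [mate_update ho]
    rw [h4 u]
    constructor
    · rintro (rfl | ⟨x, hx⟩)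
      · exact .inr ⟨v, .inl ⟨rfl, rfl⟩⟩
      · by_cases hxv : x = v
        · subst hxv; exact .inl (hx.right_unique hmw)
        · exact .inr ⟨x, .inr ⟨hxv, hx⟩⟩
    · rintro (rfl | ⟨x, ⟨-, rfl⟩ | ⟨-, hx⟩⟩)
      exacts [.inr ⟨v, hmw⟩, .inl rfl, .inr ⟨x, hx⟩]
  · have hf : Function.update frm w v w = v := by simp
    rw [Path, hf]
    refine ⟨(mate_update ho).2 (.inl ⟨rfl, rfl⟩), h1.adj _ _ hmw, hu, by simp,
      h5.congr (fun x hx => ?_) (fun y hy x hx hm => ?_) fun x hx => ?_⟩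
    · exact Function.update_of_ne (by rintro rfl; exact hwl hx) _ _
    · exact (mate_update ho).2 (.inr ⟨by rintro rfl; exact hx hv, hm⟩)
    · by_cases hxv : x = v <;> simp [hxv, hx]
  · exact List.nodup_cons.2 ⟨hwl, h6⟩
  · intro u hu
    rcases List.mem_cons.1 hu with rfl | hu
    · exact h1.lt _ _ hmw
    · exact h7 u hu
  · intro x hx hvx hux
    simp only [mate_update ho]
    by_cases hxv : x = v
    · exact ⟨c, .inl ⟨hxv, rfl⟩, by simp⟩
    · obtain ⟨u, hm, hu'⟩ := h8 x hx (by simpa [hxv] using hvx) hux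
      refine ⟨u, .inr ⟨hxv, hm⟩, ?_⟩
      rcases hu' with hu' | hu'
      · exact .inl (List.mem_cons_of_mem _ hu')
      · have : u ≠ c := by rintro rfl; exact h3 _ hm
        exact .inr (by simpa [this] using hu')
  all_goals intro u hu; have := h9 u hu; have := h10 u hu; have := h11 u hu; grind

theorem exists_cons (h : G.Search mV₀ root mV vis ptr frm c l) (hc : c ≠ root) :
    ∃ y l', l = y :: l' := by
  cases l with
  | nil => exact absurd h.path hc
  | cons y l => exact ⟨y, l, rfl⟩

/-- The root lies at the bottom of a stack without duplicates, so the program can detect a stack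
with nothing below its top by comparing the current clause with the root. -/
theorem eq_nil (h : G.Search mV₀ c mV vis ptr frm c l) : l = [] := by
  cases l with
  | nil => rfl
  | cons y l => exact absurd h.path.2.2.2.2.root_mem (List.nodup_cons.1 h.nodup).1

/-- The program stores no stack: the clause below `c` is the present holder of the variable that `c`
has lost. -/
theorem mate_frm {y : ℕ} (h : G.Search mV₀ root mV vis ptr frm c (y :: l)) :
    mV (frm c) = y + 1 := h.path.1.2

/-- The lost variable goes back to `c`, whose list is exhausted, so `closed` still holds for it; `y`
is again the clause without a variable. -/
theorem backward {y : ℕ} (h : G.Search mV₀ root mV vis ptr frm c (y :: l))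
    (hp : ptr c = G.en c) :
    G.Search mV₀ root (Function.update mV (frm c) (c + 1)) vis ptr frm y l := by
  obtain ⟨h1, h2, h3, h4, h5, h6, h7, h8, h9, h10, h11⟩ := h
  obtain ⟨hm, ha, hu, hv, hpath⟩ := h5
  have hcm := h7 c (by simp)
  have ho := ha.occurs hcm
  have hy : y ∉ l := (List.nodup_cons.1 (List.nodup_cons.1 h6).2).1
  have hyc : y ≠ c := by rintro rfl; exact (List.nodup_cons.1 h6).1 (by simp)
  constructor
  · exact h1.update hcm ha hu fun v' h' => absurd h' (h3 _)
  · exact h2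
  · intro x
    rw [mate_update ho]
    have := h1.inj x (frm c) y
    grind
  · intro u
    simp only [mate_update ho]
    rw [h4 u]
    constructor
    · rintro (rfl | ⟨x, hx⟩)
      · exact .inr ⟨frm u, .inl ⟨rfl, rfl⟩⟩
      · by_cases hxv : x = frm c
        · subst hxv; exact .inl (hx.right_unique hm)
        · exact .inr ⟨x, .inr ⟨hxv, hx⟩⟩
    · rintro (rfl | ⟨x, ⟨-, rfl⟩ | ⟨-, hx⟩⟩)
      exacts [.inr ⟨_, hm⟩, .inl rfl, .inr ⟨x, hx⟩]
  · refine hpath.congr (fun _ _ => rfl) (fun z hz x hx hxm => ?_) fun _ h => h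
    refine (mate_update ho).2 (.inr ⟨?_, hxm⟩)
    rintro rfl
    rw [hxm.right_unique hm] at hz
    exact hy hz
  · exact (List.nodup_cons.1 h6).2
  · exact fun u hu => h7 u (List.mem_cons_of_mem _ hu)
  · intro x hx hvx hux
    simp only [mate_update ho]
    by_cases hxv : x = frm c
    · exact ⟨c, .inl ⟨hxv, rfl⟩, .inr hp⟩
    · obtain ⟨u, hmu, hu'⟩ := h8 x hx hvx hux
      refine ⟨u, .inr ⟨hxv, hmu⟩, ?_⟩
      rcases hu' with hu' | hu'
      · rcases List.mem_cons.1 hu' with rfl | hu'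
        · exact absurd (h1.inj _ _ _ hmu hm) hxv
        · exact .inl hu'
      · exact .inr hu'
  all_goals assumption

/-- If the search fails then the clauses cannot be satisfied: those that it has reached have fewer
variables in all than there are clauses. -/
theorem not_saturable (h : G.Search mV₀ c mV vis ptr frm c []) (hp : ptr c = G.en c) :
    ¬ G.Saturable := by
  classical
  rintro ⟨σ, hσ, hinj⟩
  obtain ⟨h1, h2, h3, h4, h5, h6, h7, h8, h9, h10, h11⟩ := h
  have hcm := h7 c (by simp)
  -- The clauses that the search has reached. All have been scanned to the end, so all their
  -- variables are visited, and the allowed ones are held by clauses in `S` other than `c`.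
  set S := (Finset.range G.m).filter fun u => u = c ∨ ∃ v, G.Mate mV v u ∧ vis v ≠ 0 with hS
  have hlt : ∀ u ∈ S, u < G.m := fun u hu => Finset.mem_range.1 (Finset.mem_filter.1 hu).1
  have hend : ∀ u ∈ S, ptr u = G.en u := by
    intro u hu
    rcases (Finset.mem_filter.1 hu).2 with rfl | ⟨v, hv, hv'⟩
    · exact hp
    · obtain ⟨u', hm, h⟩ := h8 v hv.1 hv' (h1.unused _ _ hv)
      rw [hv.right_unique hm]
      simpa using h
  have hmate : ∀ u ∈ S, G.Mate mV (σ u) (mV (σ u) - 1) ∧ vis (σ u) ≠ 0 := by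
    intro u hu
    obtain ⟨⟨p, hp1, hp2, hp3⟩, h0⟩ := hσ u (hlt u hu)
    have hv : vis (σ u) ≠ 0 := hp3 ▸ h9 u (hlt u hu) p hp1 (by rw [hend u hu]; exact hp2)
    obtain ⟨u', hm, -⟩ := h8 (σ u) ((hσ u (hlt u hu)).1.occurs (hlt u hu)) hv h0
    have := hm.2
    exact ⟨⟨hm.1, by omega⟩, hv⟩
  -- Sending `u` to the holder of `σ u` would inject `S` into `S` without `c`.
  have hmaps : Set.MapsTo (fun u => mV (σ u) - 1) S (S.erase c) := by
    intro u hu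
    have := hmate u hu
    refine Finset.mem_erase.2 ⟨?_, ?_⟩
    · intro e
      rw [show mV (σ u) - 1 = c from e] at this
      exact h3 _ this.1
    · exact Finset.mem_filter.2 ⟨Finset.mem_range.2 (h1.lt _ _ this.1), .inr ⟨_, this⟩⟩
  have hle := Finset.card_le_card_of_injOn _ hmaps fun u hu u' hu' e => by
    have ha := (hmate u hu).1
    have hb := (hmate u' hu').1
    rw [← show mV (σ u) - 1 = mV (σ u') - 1 from e] at hb
    exact hinj (hlt u hu) (hlt u' hu') (h1.inj _ _ _ ha hb)
  have hcS : c ∈ S := Finset.mem_filter.2 ⟨Finset.mem_range.2 hcm, .inl rfl⟩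
  have := Finset.card_erase_lt_of_mem hcS
  omega

end Search

end Incidence

/-! ### The program for one choice of terms

Registers below 10 hold the data that all parts of the program share: register 2 holds the number
of clauses of `g`, register 3 the length of the input, register 4 the position at which the clauses
of `g` begin, register 5 the number of price levels, and registers 8 and 9 the constants 0 and 1.
Arrays 0, 2, 3 and 6 hold the input, the first and last positions of the clauses of `g`, and the
multiplicities of the variables in the chosen terms. -/

local infixr:30 " ;; " => Program.seq

local notation "rCount" => 20
local notation "rIndex" => 21
local notation "rRoot" => 22
local notation "rOk" => 23
local notation "rCur" => 24
local notation "rAlive" => 25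
local notation "rNext" => 26
local notation "rPos" => 27
local notation "rLevel" => 28
local notation "rEnd" => 29
local notation "rVar" => 30
local notation "rMate" => 31
local notation "rX" => 32
local notation "rY" => 33
local notation "aGiven" => 10
local notation "aMate" => 11
local notation "aPrice" => 12
local notation "aLevel" => 13
local notation "aPtr" => 14
local notation "aVis" => 15
local notation "aFrom" => 16

/-- What the program for one choice of terms may assume. -/
structure Setting (W : ℕ) (G : Incidence) (L N s : ℕ) (M : Memory) : Prop where
  var_eq : M.arr 0 = G.var
  st_eq : M.arr 2 = G.st
  en_eq : M.arr 3 = G.en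
  used_eq : M.arr 6 = G.used
  m_eq : M.reg 2 = G.m
  N_eq : M.reg 3 = N
  s_eq : M.reg 4 = s
  L_eq : M.reg 5 = L
  zero : M.reg 8 = 0
  one : M.reg 9 = 1
  L_pos : 0 < L
  L_lt : L < W
  N_le : N ≤ W
  m_lt : G.m < W
  s_le : s ≤ N
  size : N - s ≤ G.size
  le_st : ∀ u < G.m, s ≤ G.st u
  st_le : ∀ u < G.m, G.st u ≤ G.en u
  en_le : ∀ u < G.m, G.en u ≤ N

theorem Agree.mono {ρ α ρ' α' : ℕ} {M M' : Memory} (h : Agree ρ α M M') (hρ : ρ' ≤ ρ)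
    (hα : α' ≤ α) : Agree ρ' α' M M' :=
  ⟨fun r hr => h.1 r (by omega), fun A hA => h.2 A (by omega)⟩

@[simp] theorem agree_setReg {ρ α r v : ℕ} {M M' : Memory} (hr : ρ ≤ r) :
    Agree ρ α M (M'.setReg r v) ↔ Agree ρ α M M' := by
  refine ⟨fun h => ⟨fun s hs => ?_, h.2⟩, fun h => h.setReg hr⟩
  simpa [show s ≠ r by omega] using h.1 s hs

@[simp] theorem agree_setArr {ρ α A i v : ℕ} {M M' : Memory} (hA : α ≤ A) :
    Agree ρ α M (M'.setArr A i v) ↔ Agree ρ α M M' := by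
  refine ⟨fun h => ⟨h.1, fun B hB => ?_⟩, fun h => h.setArr hA⟩
  simpa [show B ≠ A by omega] using h.2 B hB

/-! ### Resetting the data, and the auction as a program -/

section

variable {W : ℕ} {G : Incidence} {L N s : ℕ} {M M' : Memory}

/-- The frame rule for a fixed choice of terms: its subprograms write only to registers and arrays
from 10 on. -/
theorem Setting.of_agree (h : Setting W G L N s M) (h' : Agree 10 10 M M') :
    Setting W G L N s M' := by
  obtain ⟨hr, hA⟩ := h'
  exact { h with
    var_eq := by rw [hA _ (by norm_num), h.var_eq]
    st_eq := by rw [hA _ (by norm_num), h.st_eq]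
    en_eq := by rw [hA _ (by norm_num), h.en_eq]
    used_eq := by rw [hA _ (by norm_num), h.used_eq]
    m_eq := by rw [hr _ (by norm_num), h.m_eq]
    N_eq := by rw [hr _ (by norm_num), h.N_eq]
    s_eq := by rw [hr _ (by norm_num), h.s_eq]
    L_eq := by rw [hr _ (by norm_num), h.L_eq]
    zero := by rw [hr _ (by norm_num), h.zero]
    one := by rw [hr _ (by norm_num), h.one] }

theorem Incidence.Auction.of_iff {mV price level ptr gl : ℕ → ℕ} {g : ℕ} {act act' : ℕ → Prop}
    (h : G.Auction L mV price level ptr gl g act) (hact : ∀ u, act u ↔ act' u) :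
    G.Auction L mV price level ptr gl g act' := by
  rwa [← funext fun u => propext (hact u)]

/-- Resetting the variables named at the positions from `s` to `N` therefore suffices, at a cost
independent of the number of variables. The length words in between are treated as indices too,
which is harmless. -/
theorem Setting.exists_pos (h : Setting W G L N s M) {v : ℕ} (hv : G.Occurs v) :
    ∃ q, s ≤ q ∧ q < N ∧ G.var q = v := by
  obtain ⟨u, hu, p, h1, h2, h3⟩ := hv
  exact ⟨p, (h.le_st u hu).trans h1, h2.trans_le (h.en_le u hu), h3⟩

/-- Frees all variables, and sets their prices to `0` or, for the forbidden ones, to `L`. -/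
def resetVars : Program :=
  .add rPos 4 8 ;;
  .loop rPos 3
    (.load rVar 0 rPos ;;
     .load rX 6 rVar ;;
     .ite 8 rX (.store aPrice rVar 5) (.store aPrice rVar 8) ;;
     .store aMate rVar 8 ;;
     .add rPos rPos 9)

/-- Starts all clauses at level `0` and at their first variable. -/
def resetClauses : Program :=
  .const rPos 0 ;;
  .loop rPos 2
    (.store aLevel rPos 8 ;;
     .load rX 2 rPos ;;
     .store aPtr rPos rX ;;
     .add rPos rPos 9)

/-- Marks the forbidden variables as visited, and no others. -/
def resetVisited : Program :=
  .add rPos 4 8 ;;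
  .loop rPos 3
    (.load rVar 0 rPos ;;
     .load rX 6 rVar ;;
     .store aVis rVar rX ;;
     .add rPos rPos 9)

theorem ends_resetVars (h : Setting W G L N s M) :
    Ends W resetVars M fun M' T => Agree 24 11 M M' ∧ (∀ v, G.Occurs v → M'.arr aMate v = 0) ∧
      (∀ v, G.Occurs v → M'.arr aPrice v = if G.used v = 0 then 0 else L) ∧
      T ≤ 9 * G.size + 3 := by
  have hN := h.N_le
  have hs := h.s_le
  rw [resetVars, ends_seq, ends_add]
  refine ⟨by simp [h.s_eq, h.zero]; omega, ?_⟩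
  refine ends_loop (fun B M' => Agree 24 11 M M' ∧ s ≤ M'.reg rPos ∧ 9 * (N - M'.reg rPos) ≤ B ∧
    ∀ q, s ≤ q → q < M'.reg rPos → M'.arr aMate (G.var q) = 0 ∧
      M'.arr aPrice (G.var q) = if G.used (G.var q) = 0 then 0 else L) (B := 9 * (N - s)) ?_ ?_ ?_
  · simp [h.s_eq, h.zero, Agree.refl]
    intros; omega
  · rintro B M₁ ⟨hA, h1, h2, h3⟩ hlt
    have hS := h.of_agree (hA.mono (by norm_num) (by norm_num))
    simp [hS.N_eq] at hlt
    simp [ends_seq, ends_ite, hS.zero, hS.one, hS.var_eq, hS.used_eq, hS.L_eq, hA]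
    constructor <;> intro hu <;>
      refine ⟨by omega, 9 * (N - (M₁.reg rPos + 1)), ⟨by omega, le_rfl, fun q hq hq' => ?_⟩,
        by omega⟩ <;>
      have := h3 q hq <;> grind
  · rintro B' M' T ⟨hA, h1, h2, h3⟩ hle hT
    have hS := h.of_agree (hA.mono (by norm_num) (by norm_num))
    rw [hS.N_eq] at hle
    have := h.size
    refine ⟨hA, fun v hv => ?_, fun v hv => ?_, by omega⟩ <;>
      obtain ⟨q, hq, hq', rfl⟩ := h.exists_pos hv
    · exact (h3 q hq (by omega)).1
    · exact (h3 q hq (by omega)).2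

theorem ends_resetClauses (h : Setting W G L N s M) :
    Ends W resetClauses M fun M' T => Agree 24 13 M M' ∧ (∀ u < G.m, M'.arr aLevel u = 0) ∧
      (∀ u < G.m, M'.arr aPtr u = G.st u) ∧ T ≤ 6 * G.size + 3 := by
  rw [resetClauses, ends_seq, ends_const]
  refine ⟨by omega, ?_⟩
  refine ends_loop (fun B M' => Agree 24 13 M M' ∧ 6 * (G.m - M'.reg rPos) ≤ B ∧
    ∀ u < M'.reg rPos, M'.arr aLevel u = 0 ∧ M'.arr aPtr u = G.st u) (B := 6 * G.m) ?_ ?_ ?_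
  · simp [Agree.refl]
  · rintro B M₁ ⟨hA, h2, h3⟩ hlt
    have hS := h.of_agree (hA.mono (by norm_num) (by norm_num))
    have := h.m_lt
    simp [hS.m_eq] at hlt
    simp [ends_seq, hS.zero, hS.one, hS.st_eq, hA]
    refine ⟨by omega, 6 * (G.m - (M₁.reg rPos + 1)), ⟨by omega, fun q hq => ?_⟩, by omega⟩
    have := h3 q
    grind
  · rintro B' M' T ⟨hA, h2, h3⟩ hle hT
    have hS := h.of_agree (hA.mono (by norm_num) (by norm_num))
    rw [hS.m_eq] at hle
    have := G.le_size
    exact ⟨hA, fun u hu => (h3 u (by omega)).1, fun u hu => (h3 u (by omega)).2, by omega⟩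

theorem ends_resetVisited (h : Setting W G L N s M) :
    Ends W resetVisited M fun M' T => Agree 24 15 M M' ∧
      (∀ v, G.Occurs v → M'.arr aVis v = G.used v) ∧ T ≤ 6 * G.size + 3 := by
  have hN := h.N_le
  have hs := h.s_le
  rw [resetVisited, ends_seq, ends_add]
  refine ⟨by simp [h.s_eq, h.zero]; omega, ?_⟩
  refine ends_loop (fun B M' => Agree 24 15 M M' ∧ s ≤ M'.reg rPos ∧ 6 * (N - M'.reg rPos) ≤ B ∧
    ∀ q, s ≤ q → q < M'.reg rPos → M'.arr aVis (G.var q) = G.used (G.var q))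
    (B := 6 * (N - s)) ?_ ?_ ?_
  · simp [h.s_eq, h.zero, Agree.refl]
    intros; omega
  · rintro B M₁ ⟨hA, h1, h2, h3⟩ hlt
    have hS := h.of_agree (hA.mono (by norm_num) (by norm_num))
    simp [hS.N_eq] at hlt
    simp [ends_seq, hS.one, hS.var_eq, hS.used_eq, hA]
    refine ⟨by omega, 6 * (N - (M₁.reg rPos + 1)), ⟨by omega, by omega, fun q hq hq' => ?_⟩,
      by omega⟩
    have := h3 q hq
    grind
  · rintro B' M' T ⟨hA, h1, h2, h3⟩ hle hT
    have hS := h.of_agree (hA.mono (by norm_num) (by norm_num))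
    rw [hS.N_eq] at hle
    have := h.size
    refine ⟨hA, fun v hv => ?_, by omega⟩
    obtain ⟨q, hq, hq', rfl⟩ := h.exists_pos hv
    exact h3 q hq (by omega)

/-- One step of the auction: the current clause looks at its next variable. -/
def bid : Program :=
  .load rLevel aLevel rCur ;;
  .load rPos aPtr rCur ;;
  .load rEnd 3 rCur ;;
  .ite rPos rEnd
    (.load rVar 0 rPos ;;
     .add rPos rPos 9 ;;
     .store aPtr rCur rPos ;;
     .load rX aPrice rVar ;;
     .ite rLevel rX .skip
       (.add rLevel rLevel 9 ;;
        .store aPrice rVar rLevel ;;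
        .load rMate aMate rVar ;;
        .add rX rCur 9 ;;
        .store aMate rVar rX ;;
        .ite 8 rMate (.sub rCur rMate 9) (.const rAlive 0)))
    (.add rLevel rLevel 9 ;;
     .store aLevel rCur rLevel ;;
     .load rX 2 rCur ;;
     .store aPtr rCur rX ;;
     .ite rLevel 5 .skip
       (.store aGiven rCount rCur ;;
        .add rCount rCount 9 ;;
        .const rAlive 0))

/-- The auction. -/
def auction : Program :=
  .const rNext 0 ;;
  .const rCount 0 ;;
  .const rAlive 0 ;;
  .loop rNext 2
    (.add rCur rNext 8 ;;
     .add rNext rNext 9 ;;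
     .const rAlive 1 ;;
     .loop 8 rAlive bid)

/-- The invariant of the auction. -/
structure AuctionInv (G : Incidence) (L : ℕ) (M₀ : Memory) (B : ℕ) (M : Memory) : Prop where
  agree : Agree 20 10 M₀ M
  auction : G.Auction L (M.arr aMate) (M.arr aPrice) (M.arr aLevel) (M.arr aPtr) (M.arr aGiven)
    (M.reg rCount) fun u => (0 < M.reg rAlive ∧ u = M.reg rCur) ∨ (M.reg rNext ≤ u ∧ u < G.m)
  cur_lt : 0 < M.reg rAlive → M.reg rCur < M.reg rNext
  budget : 25 * G.potential L (M.arr aLevel) (M.arr aPtr) + 10 * (G.m - M.reg rNext) ≤ B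

theorem ends_bid {M₀ : Memory} {B : ℕ} (h : Setting W G L N s M₀) (hI : AuctionInv G L M₀ B M)
    (ha : M.reg 8 < M.reg rAlive) :
    Ends W bid M fun M' T => ∃ B', AuctionInv G L M₀ B' M' ∧ T + 1 + B' ≤ B := by
  obtain ⟨hA, hI, hc, hB⟩ := hI
  have hS := h.of_agree (hA.mono (by norm_num) (by norm_num))
  have := h.m_lt
  have := h.N_le
  have := h.L_lt
  rw [hS.zero] at ha
  have hact : (0 < M.reg rAlive ∧ M.reg rCur = M.reg rCur) ∨
    (M.reg rNext ≤ M.reg rCur ∧ M.reg rCur < G.m) := .inl ⟨ha, rfl⟩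
  have hcm := hI.act_lt _ hact
  have hcl := hI.act_level _ hact
  have hen := h.en_le _ hcm
  have hle := hI.le_en _ hcm
  simp [bid, ends_seq, ends_ite, hS.zero, hS.one, hS.var_eq, hS.st_eq, hS.en_eq, hS.L_eq]
  constructor
  · intro hp
    -- One unit of potential is worth 25 steps, more than one bid and its loop test take.
    have hpot := G.potential_advance (L := L) (level := M.arr aLevel) hcm hp
    refine ⟨by omega, fun hv => ?_, fun hv => ⟨by omega, by omega, fun hw => ?_, fun hw => ?_⟩⟩
    · refine ⟨B - 25, ⟨by simpa, ?_, by simpa using hc, by simp; omega⟩, by omega⟩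
      simpa using hI.skip hact hp hv
    · have hm : G.Mate (M.arr aMate) (G.var (M.arr aPtr (M.reg rCur))) (M.arr aMate (G.var
        (M.arr aPtr (M.reg rCur))) - 1) :=
        ⟨⟨_, hcm, _, hI.st_le _ hcm, hp, rfl⟩, by omega⟩
      -- The displaced clause holds a variable, hence is not active; in particular it is not one of
      -- the clauses still waiting to enter.
      have hfree := fun h' => hI.act_free _ _ h' hm
      have hml := hI.matching.lt _ _ hm
      refine ⟨B - 25, ⟨by simpa, ?_, ?_, by simp; omega⟩, by omega⟩
      · simp
        refine (hI.take hact hp hv).of_iff fun u => ?_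
        omega
      · simp
        by_contra!
        exact hfree (.inr ⟨this.2, hml⟩)
    · refine ⟨B - 25, ⟨by simpa, ?_, by simp, by simp; omega⟩, by omega⟩
      simp
      refine (hI.take hact hp hv).of_iff fun u => ?_
      have := hc ha
      omega
  · intro hp
    replace hp := le_antisymm hle hp
    have hpot := G.potential_raise hcm hp hcl
    refine ⟨by omega, fun hl => ?_, fun hl => ?_⟩
    · refine ⟨B - 25, ⟨by simpa, ?_, by simpa using hc, by simp; omega⟩, by omega⟩
      simpa using hI.raise hact hp hl
    · have hg := hI.giveUp hact hp (by omega)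
      have := hg.given_le
      refine ⟨by omega, B - 25, ⟨by simpa, ?_, by simp, by simp; omega⟩, by omega⟩
      simp
      refine hg.of_iff fun u => ?_
      have := hc ha
      omega

theorem ends_auction (h : Setting W G L N s M) (hm : ∀ v, G.Occurs v → M.arr aMate v = 0)
    (hp : ∀ v, G.Occurs v → M.arr aPrice v = if G.used v = 0 then 0 else L)
    (hl : ∀ u < G.m, M.arr aLevel u = 0) (hptr : ∀ u < G.m, M.arr aPtr u = G.st u) :
    Ends W auction M fun M' T => Agree 20 10 M M' ∧
      (G.Auction L (M'.arr aMate) (M'.arr aPrice) (M'.arr aLevel) (M'.arr aPtr) (M'.arr aGiven)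
        (M'.reg rCount) fun _ => False) ∧ T ≤ 25 * ((L + 1) * G.size) + 10 * G.size + 5 := by
  have hpot := G.potential_le (L := L) (level := M.arr aLevel) hptr
  have := h.m_lt
  have := h.L_pos
  simp only [auction, ends_seq, ends_const]
  refine ⟨by omega, by omega, by omega, ?_⟩
  refine ends_loop (fun B M₁ => AuctionInv G L M B M₁ ∧ M₁.reg rAlive = 0)
    (B := 25 * ((L + 1) * G.size) + 10 * G.m) ?_ ?_ ?_
  · refine ⟨⟨by simp [Agree.refl], ?_, by simp, by simp; omega⟩, by simp⟩
    simp
    exact Incidence.Auction.init h.L_pos h.st_le hm hp hl hptr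
  · rintro B M₁ ⟨⟨hA, hI, hc, hB⟩, ha⟩ hlt
    have hS := h.of_agree (hA.mono (by norm_num) (by norm_num))
    rw [hS.m_eq] at hlt
    simp only [ends_seq, ends_const, ends_add]
    simp [hS.zero, hS.one]
    refine ⟨by omega, by omega, by omega, ?_⟩
    -- The ten steps set aside for each waiting clause pay for letting it enter.
    refine ends_loop (fun B M₁ => AuctionInv G L M B M₁) (B := B - 10) ?_ ?_ ?_
    · refine ⟨by simpa, ?_, by simp, by simp; omega⟩
      simp
      refine hI.of_iff fun u => ?_
      omega
    · exact fun B M₁ hM hlt => ends_bid h hM hlt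
    · intro B' M₂ T h2 hle hT
      have hS := h.of_agree (h2.agree.mono (by norm_num) (by norm_num))
      rw [hS.zero] at hle
      exact ⟨B', ⟨h2, by omega⟩, by omega⟩
  · rintro B' M' T ⟨⟨hA, hI, hc, hB⟩, ha⟩ hle hT
    have hS := h.of_agree (hA.mono (by norm_num) (by norm_num))
    rw [hS.m_eq] at hle
    have := G.le_size
    refine ⟨hA, hI.of_iff fun u => ?_, by omega⟩
    simp
    omega

end

/-! ### Augmenting paths as a program, and the decision for one choice of terms -/

section

variable {W : ℕ} {G : Incidence} {L N s : ℕ} {M M' : Memory}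

/-- One step of the search: the current clause looks at its next variable. -/
def probe : Program :=
  .load rPos aPtr rCur ;;
  .load rEnd 3 rCur ;;
  .ite rPos rEnd
    (.load rVar 0 rPos ;;
     .add rPos rPos 9 ;;
     .store aPtr rCur rPos ;;
     .load rX aVis rVar ;;
     .ite 8 rX .skip
       (.store aVis rVar 9 ;;
        .load rMate aMate rVar ;;
        .add rX rCur 9 ;;
        .store aMate rVar rX ;;
        .ite 8 rMate
          (.sub rCur rMate 9 ;;
           .store aFrom rCur rVar)
          (.const rAlive 0)))
    (.sub rX rCur rRoot ;;
     .sub rY rRoot rCur ;;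
     .add rX rX rY ;;
     .ite 8 rX
       (.load rVar aFrom rCur ;;
        .load rMate aMate rVar ;;
        .add rX rCur 9 ;;
        .store aMate rVar rX ;;
        .sub rCur rMate 9)
       (.const rAlive 0 ;;
        .const rOk 0))

/-- The depth first search for a variable for the clause in register `rRoot`. -/
def search : Program :=
  .add rCur rRoot 8 ;;
  .const rAlive 1 ;;
  .loop 8 rAlive probe

/-- The possible results of a search for a variable for the clause `root`. -/
def SearchDone (G : Incidence) (mV₀ : ℕ → ℕ) (root : ℕ) (M : Memory) : Prop :=
  (M.reg rOk = 1 ∧ G.IsMatching (M.arr aMate) ∧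
    ∀ u, (u = root ∨ ∃ v, G.Mate mV₀ v u) ↔ ∃ v, G.Mate (M.arr aMate) v u) ∨
  (M.reg rOk = 0 ∧ ¬ G.Saturable)

/-- The invariant of the search. -/
structure SearchInv (G : Incidence) (mV₀ : ℕ → ℕ) (root : ℕ) (M₀ : Memory) (B : ℕ)
    (M : Memory) : Prop where
  agree : Agree 23 11 M₀ M
  alive : 0 < M.reg rAlive → M.reg rOk = 1 ∧ ∃ l,
    G.Search mV₀ root (M.arr aMate) (M.arr aVis) (M.arr aPtr) (M.arr aFrom) (M.reg rCur) l ∧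
      20 * (2 * G.potential 0 (fun _ => 0) (M.arr aPtr) + l.length + 1) ≤ B
  done : M.reg rAlive = 0 → SearchDone G mV₀ root M

theorem ends_probe {M₀ : Memory} {B root : ℕ} {mV₀ : ℕ → ℕ} (h : Setting W G L N s M₀)
    (hroot : M₀.reg rRoot = root) (hr : root < G.m) (hI : SearchInv G mV₀ root M₀ B M)
    (ha : M.reg 8 < M.reg rAlive) :
    Ends W probe M fun M' T => ∃ B', SearchInv G mV₀ root M₀ B' M' ∧ T + 1 + B' ≤ B := by
  obtain ⟨hA, hI, -⟩ := hI
  have hS := h.of_agree (hA.mono (by norm_num) (by norm_num))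
  have := h.m_lt
  have := h.N_le
  rw [hS.zero] at ha
  obtain ⟨hok, l, hI, hB⟩ := hI ha
  have hcm := hI.lt _ (List.mem_cons_self ..)
  have hen := h.en_le _ hcm
  have hle := hI.le_en _ hcm
  have hroot' : M.reg rRoot = root := (hA.1 _ (by norm_num)).trans hroot
  simp [probe, ends_seq, ends_ite, hS.zero, hS.one, hS.var_eq, hS.en_eq, hroot']
  constructor
  · intro hp
    -- Level bound `0` leaves only the unscanned positions in the potential. Each is worth two units
    -- of 20 steps: one for the present step, and one saved for leaving the clause that the step may
    -- push.
    have hpot := G.potential_advance (L := 0) (level := fun _ => 0) hcm hp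
    refine ⟨by omega, fun hv => ?_, fun hv => ⟨by omega, fun hw => ?_, fun hw => ?_⟩⟩
    · refine ⟨B - 40, ⟨by simpa, ?_, by simp; omega⟩, by omega⟩
      simp
      exact fun _ => ⟨hok, l, hI.skip hp (by omega), by omega⟩
    · refine ⟨B - 20, ⟨by simpa, ?_, by simp; omega⟩, by omega⟩
      simp
      exact fun _ => ⟨hok, _, hI.forward hp hv (by omega), by simp; omega⟩
    · refine ⟨B - 40, ⟨by simpa, by simp, ?_⟩, by omega⟩
      simp
      exact .inl ⟨by simpa, by simpa using hI.isMatching_update hp hv,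
        by simpa using hI.success hp hw⟩
  · intro hp
    replace hp := le_antisymm hle hp
    refine ⟨by omega, fun hc => ?_, fun hc hc' => ?_⟩
    · obtain ⟨y, l, rfl⟩ := hI.exists_cons (by rintro e; simp [e] at hc)
      have hb := hI.backward hp
      have hy := hI.mate_frm
      simp at hB
      refine ⟨by omega, B - 20, ⟨by simpa, ?_, by simp; omega⟩, by omega⟩
      simp [hy]
      exact fun _ => ⟨hok, _, hb, by omega⟩
    -- The sum of the two truncated differences vanishes only if the clauses are equal.
    · have hcr : M.reg rCur = root := by omega
      rw [← hcr] at hI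
      obtain rfl := hI.eq_nil
      refine ⟨B - 20, ⟨?_, by simp, ?_⟩, by omega⟩
      · simpa
      · simp
        exact .inr ⟨by simp, hI.not_saturable hp⟩

theorem ends_search (h : Setting W G L N s M) (hok : M.reg rOk = 1)
    (hM : G.IsMatching (M.arr aMate)) (hr : M.reg rRoot < G.m)
    (hf : ∀ v, ¬ G.Mate (M.arr aMate) v (M.reg rRoot))
    (hv : ∀ v, G.Occurs v → M.arr aVis v = G.used v) (hp : ∀ u < G.m, M.arr aPtr u = G.st u) :
    Ends W search M fun M' T => Agree 23 11 M M' ∧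
      SearchDone G (M.arr aMate) (M.reg rRoot) M' ∧ T ≤ 40 * G.size + 23 := by
  have hpot := G.potential_le (L := 0) (level := fun _ => 0) hp
  have := h.m_lt
  simp only [search, ends_seq, ends_const, ends_add]
  refine ⟨by simp [h.zero]; omega, by omega, ?_⟩
  refine ends_loop (fun B M₁ => SearchInv G (M.arr aMate) (M.reg rRoot) M B M₁)
    (B := 40 * G.size + 20) ?_ ?_ ?_
  · refine ⟨by simp [Agree.refl], ?_, by simp⟩
    simp [h.zero, hok]
    exact ⟨[], .init hM hr hf h.st_le (fun v ho => by rw [hv v ho]) hp, by simp; omega⟩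
  · exact fun B M₁ hI hlt => ends_probe h rfl hr hI hlt
  · intro B' M' T hI hle hT
    have hS := h.of_agree (hI.agree.mono (by norm_num) (by norm_num))
    rw [hS.zero] at hle
    exact ⟨hI.agree, hI.done (by omega), by omega⟩

/-- Decides whether the clauses of `g` can be satisfied by distinct variables that do not occur in
the chosen terms. -/
def saturate : Program :=
  resetVars ;;
  resetClauses ;;
  auction ;;
  .ite 5 rCount
    (.const rOk 0)
    (.const rOk 1 ;;
     .const rIndex 0 ;;
     .loop rIndex rCount
       (.load rRoot aGiven rIndex ;;
        resetClauses ;;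
        resetVisited ;;
        search ;;
        .ite rOk 9
          (.add rIndex rCount 8)
          (.add rIndex rIndex 9)))

/-- The invariant of the loop over the clauses that have given up. -/
structure AugmentInv (G : Incidence) (L : ℕ) (M₀ : Memory) (B : ℕ) (M : Memory) : Prop where
  agree : Agree 20 10 M₀ M
  index_le : M.reg rIndex ≤ M.reg rCount
  count_le : M.reg rCount ≤ L
  given_lt : ∀ i < M.reg rCount, M.arr aGiven i < G.m
  given_inj : ∀ i < M.reg rCount, ∀ j < M.reg rCount, M.arr aGiven i = M.arr aGiven j → i = j
  state : (M.reg rOk = 1 ∧ G.IsMatching (M.arr aMate) ∧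
      (∀ i, M.reg rIndex ≤ i → i < M.reg rCount → ∀ v, ¬ G.Mate (M.arr aMate) v (M.arr aGiven i)) ∧
      ∀ u < G.m, (∃ v, G.Mate (M.arr aMate) v u) ∨
        ∃ i, M.reg rIndex ≤ i ∧ i < M.reg rCount ∧ M.arr aGiven i = u) ∨
    (M.reg rOk = 0 ∧ M.reg rIndex = M.reg rCount ∧ ¬ G.Saturable)
  budget : (M.reg rCount - M.reg rIndex) * (52 * G.size + 40) ≤ B

/-- More than `L` clauses giving up refutes satisfiability, as `L * (L + 1)` exceeds `m`. Otherwise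
at most `L` searches of linear cost remain, which matches the cost of the auction. -/
theorem ends_saturate (h : Setting W G L N s M) (hL : G.m ≤ L * L) (hm : 0 < G.m) :
    Ends W saturate M fun M' T => Agree 20 10 M M' ∧ (M'.reg rOk = 1 ↔ G.Saturable) ∧
      (M'.reg rOk = 1 ∨ M'.reg rOk = 0) ∧ T ≤ 200 * (L * G.size) := by
  have hLpos := h.L_pos
  have hsize : 0 < G.size := hm.trans_le G.le_size
  have hLs : G.size ≤ L * G.size := Nat.le_mul_of_pos_left _ hLpos
  have hLs' : L ≤ L * G.size := Nat.le_mul_of_pos_right _ hsize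
  rw [saturate, ends_seq]
  refine (ends_resetVars h).mono ?_
  rintro M₁ T₁ ⟨hA₁, hm₁, hp₁, hT₁⟩
  have hS₁ := h.of_agree (hA₁.mono (by norm_num) (by norm_num))
  rw [ends_seq]
  refine (ends_resetClauses hS₁).mono ?_
  rintro M₂ T₂ ⟨hA₂, hl₂, hptr₂, hT₂⟩
  have hS₂ := hS₁.of_agree (hA₂.mono (by norm_num) (by norm_num))
  rw [ends_seq]
  rw [← hA₂.2 _ (by norm_num)] at hm₁ hp₁
  refine (ends_auction hS₂ hm₁ hp₁ hl₂ hptr₂).mono ?_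
  rintro M₃ T₃ ⟨hA₃, hI, hT₃⟩
  have hA : Agree 20 10 M M₃ :=
    ((hA₁.mono (by norm_num) (by norm_num)).trans (hA₂.mono (by norm_num) (by norm_num))).trans hA₃
  have hS₃ := h.of_agree (hA.mono (by norm_num) (by norm_num))
  have hL1 : (L + 1) * G.size = L * G.size + G.size := by ring
  rw [hL1] at hT₃
  have := h.L_lt
  rw [ends_ite, hS₃.L_eq]
  constructor
  · intro hlt
    simp
    refine ⟨by simpa, fun hG => ?_, by omega⟩
    have h1 := hI.mul_le hG
    have : L * (L + 1) ≤ L * M₃.reg rCount := Nat.mul_le_mul_left _ hlt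
    rw [mul_add] at this
    omega
  · intro hle
    simp only [ends_seq, ends_const]
    refine ⟨by omega, by omega, ?_⟩
    refine ends_loop (fun B M' => AugmentInv G L M B M') (B := L * (52 * G.size + 40)) ?_ ?_ ?_
    · refine ⟨by simpa, by simp, by simpa, by simpa using hI.given_lt,
        by simpa using hI.given_inj, .inl ?_, ?_⟩
      · simp
        refine ⟨hI.matching, fun i hi v => hI.given_free hi, fun u hu => ?_⟩
        simpa using hI.cover u hu
      · simp
        exact hle
    · rintro B M₄ ⟨hA₄, hi₄, hc₄, hgl₄, hgi₄, hs₄, hB₄⟩ hlt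
      obtain ⟨hok₄, hM₄, hfr₄, hcov₄⟩ | ⟨-, h4, -⟩ := hs₄
      swap
      · omega
      have hS₄ := h.of_agree (hA₄.mono (by norm_num) (by norm_num))
      rw [ends_seq, ends_load, ends_seq]
      refine (ends_resetClauses (hS₄.of_agree (by simp [Agree.refl]))).mono ?_
      rintro M₅ T₅ ⟨hA₅, -, hptr₅, hT₅⟩
      have hA₅' : Agree 22 13 M₄ M₅ :=
        (Agree.refl M₄).setReg le_rfl |>.trans (hA₅.mono (by norm_num) (by norm_num))
      have hS₅ := hS₄.of_agree (hA₅'.mono (by norm_num) (by norm_num))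
      rw [ends_seq]
      refine (ends_resetVisited hS₅).mono ?_
      rintro M₆ T₆ ⟨hA₆, hvis₆, hT₆⟩
      have hS₆ := hS₅.of_agree (hA₆.mono (by norm_num) (by norm_num))
      have hA₆' : Agree 22 13 M₄ M₆ := hA₅'.trans (hA₆.mono (by norm_num) (by norm_num))
      have hroot : M₆.reg rRoot = M₄.arr aGiven (M₄.reg rIndex) := by
        rw [hA₆.1 _ (by norm_num), hA₅.1 _ (by norm_num)]; simp
      have hok₆ : M₆.reg rOk = 1 := by
        rw [hA₆.1 _ (by norm_num), hA₅.1 _ (by norm_num)]; simpa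
      rw [ends_seq]
      have hmate : M₆.arr aMate = M₄.arr aMate := hA₆'.2 _ (by norm_num)
      refine (ends_search hS₆ hok₆ (by rwa [hmate]) (by rw [hroot]; exact hgl₄ _ hlt)
        (by rw [hroot, hmate]; exact hfr₄ _ le_rfl hlt) hvis₆
        (by rw [hA₆.2 _ (by norm_num)]; exact hptr₅)).mono ?_
      rintro M₇ T₇ ⟨hA₇, hdone, hT₇⟩
      rw [hroot, hmate] at hdone
      have hA₇' : Agree 22 11 M₄ M₇ :=
        (hA₆'.mono (by norm_num) (by norm_num)).trans (hA₇.mono (by norm_num) (by norm_num))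
      have hS₇ := hS₄.of_agree (hA₇'.mono (by norm_num) (by norm_num))
      have hA₇₀ : Agree 20 10 M M₇ := hA₄.trans (hA₇'.mono (by norm_num) (by norm_num))
      have e1 : M₇.reg rCount = M₄.reg rCount := hA₇'.1 _ (by norm_num)
      have e2 : M₇.reg rIndex = M₄.reg rIndex := hA₇'.1 _ (by norm_num)
      have e3 : M₇.arr aGiven = M₄.arr aGiven := hA₇'.2 _ (by norm_num)
      obtain ⟨d, hd⟩ : ∃ d, M₄.reg rCount - M₄.reg rIndex = d + 1 :=
        ⟨_, (Nat.succ_pred_eq_of_pos (by omega)).symm⟩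
      have hd' : M₄.reg rCount - (M₄.reg rIndex + 1) = d := by omega
      rw [hd, add_mul, one_mul] at hB₄
      simp [ends_ite, hS₇.zero, hS₇.one, e1, e2]
      constructor
      · intro hok
        obtain ⟨h1, -, -⟩ | ⟨-, hn⟩ := hdone
        · omega
        -- After a failed search the index jumps to the end of the list, so no budget is needed.
        refine ⟨by omega, 0, ⟨by simpa, by simp [e1], by simp [e1, hc₄], by simpa [e1, e3],
          by simpa [e1, e3], .inr ?_, by simp [e1]⟩, by omega⟩
        simp [hok, hn, e1]
      · intro hok
        obtain ⟨h1, hM₇, hiff⟩ | ⟨h1, hn⟩ := hdone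
        swap
        · omega
        refine ⟨by omega, d * (52 * G.size + 40), ⟨by simpa, by simp [e1]; omega, by simp [e1,
          hc₄], by simpa [e1, e3], by simpa [e1, e3], .inl ?_, by simp [e1, hd']⟩, by omega⟩
        simp [h1, hM₇, e1, e3]
        -- A successful search adds just its root to the served clauses. Later entries of the list
        -- differ from the root, so they are still unserved, and no served clause is lost.
        refine ⟨fun i hi hi' v hv => ?_, fun u hu => ?_⟩
        · rcases (hiff _).2 ⟨v, hv⟩ with h' | ⟨v', h'⟩
          · have := hgi₄ _ hi' _ hlt h'
            omega
          · exact hfr₄ i (by omega) hi' _ h'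
        · rcases hcov₄ u hu with h' | ⟨i, hi, hi', h'⟩
          · exact .inl ((hiff u).1 (.inr h'))
          · by_cases hii : i = M₄.reg rIndex
            · subst hii
              exact .inl ((hiff u).1 (.inl h'.symm))
            · exact .inr ⟨i, by omega, hi', h'⟩
    · rintro B' M' T ⟨hA₄, hi₄, hc₄, hgl₄, hgi₄, hs₄, hB₄⟩ hle' hT
      have hmul : L * (52 * G.size + 40) = 52 * (L * G.size) + 40 * L := by ring
      refine ⟨hA₄, ?_, ?_, by omega⟩
      · obtain ⟨h1, h2, h3, h4⟩ | ⟨h1, h2, h3⟩ := hs₄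
        · refine iff_of_true h1 (G.saturable_of_forall_mate h2 fun u hu => ?_)
          rcases h4 u hu with h' | ⟨i, hi, hi', -⟩
          · exact h'
          · omega
        · exact iff_of_false (by omega) h3
      · obtain ⟨h1, -⟩ | ⟨h1, -⟩ := hs₄ <;> simp [h1]

end

local notation "rDepth" => 18
local notation "rRun" => 19
local notation "rQ" => 10
local notation "rE" => 11
local notation "rV" => 12
local notation "rC" => 13
local notation "rFlag" => 14
local notation "aStart" => 1
local notation "aTerm" => 4
local notation "aLeft" => 5
local notation "aUsed" => 6

/-! ### Going through the choices of terms -/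

section Reach

variable {W a b : ℕ} {p : Program} {M : Memory} {R R' : Memory → ℕ → Prop}

/-- Started in `M`, the loop passes through a memory, before one of its tests, that satisfies `R`
together with the number of steps made until then. -/
def Reach (W a b : ℕ) (p : Program) (M : Memory) (R : Memory → ℕ → Prop) : Prop :=
  ∀ Q : Memory → ℕ → Prop,
    (∀ M' T, R M' T → Ends W (.loop a b p) M' fun M'' T' => Q M'' (T + T')) →
      Ends W (.loop a b p) M Q

theorem Reach.done (h : R M 0) : Reach W a b p M R := fun Q hQ => by
  simpa using hQ M 0 h

theorem Reach.step (hlt : M.reg a < M.reg b)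
    (h : Ends W p M fun M₁ T₁ => Reach W a b p M₁ fun M₂ T₂ => R M₂ (T₁ + T₂ + 1)) :
    Reach W a b p M R := by
  refine fun Q hQ => ends_loop_of_lt hlt (h.mono fun M₁ T₁ h₁ => h₁ _ fun M₂ T₂ h₂ => ?_)
  refine (hQ _ _ h₂).mono fun M₃ T₃ h₃ => ?_
  rwa [show T₁ + (T₂ + T₃) + 1 = T₁ + T₂ + 1 + T₃ by omega]

/-- The recursion is run by one loop, so a recursive call is a stretch of iterations instead of a
subprogram. Such stretches compose. -/
theorem Reach.trans (h : Reach W a b p M R)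
    (h' : ∀ M₁ T₁, R M₁ T₁ → Reach W a b p M₁ fun M₂ T₂ => R' M₂ (T₁ + T₂)) :
    Reach W a b p M R' := by
  refine fun Q hQ => h _ fun M₁ T₁ h₁ => h' _ _ h₁ _ fun M₂ T₂ h₂ => ?_
  refine (hQ _ _ h₂).mono fun M₃ T₃ h₃ => ?_
  rwa [← add_assoc]

theorem Reach.mono (h : Reach W a b p M R) (h' : ∀ M T, R M T → R' M T) : Reach W a b p M R' :=
  fun Q hQ => h Q fun M' T hR => hQ M' T (h' _ _ hR)

end Reach

/-- The word `X` is in the array `a` from position `q` on. -/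
def VarsAt (a : ℕ → ℕ) : ℕ → List ℕ → Prop
  | _, [] => True
  | q, x :: X => a q = x ∧ VarsAt a (q + 1) X

/-- The encodings of the terms `F` are in the array `a` from position `p` on, before `N`. -/
def TermsAt (a : ℕ → ℕ) (N : ℕ) : ℕ → List (List ℕ) → Prop
  | _, [] => True
  | p, X :: F => a p = X.length ∧ VarsAt a (p + 1) X ∧ p + 1 + X.length ≤ N ∧
      TermsAt a N (p + 1 + X.length) F

/-- The encodings of the clauses `f` are in the array `a` before `N`, and `cs i`, `cs (i + 1)`, …,
`cs k` are their starting points and the end. -/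
def ClausesAt (a : ℕ → ℕ) (N : ℕ) (cs : ℕ → ℕ) (k : ℕ) : ℕ → List (List (List ℕ)) → Prop
  | i, [] => i = k ∧ 0 < a (cs i) ∧ cs i < N
  | i, F :: f => i < k ∧ a (cs i) = F.length ∧ cs i < N ∧ TermsAt a N (cs i + 1) F ∧
      ClausesAt a N cs k (i + 1) f

/-- Adds the current term of the current clause to the multiplicities, and sets `rFlag` if one of
its variables then occurs twice. -/
def addTerm : Program :=
  .load rQ aTerm rDepth ;;
  .load rE 0 rQ ;;
  .add rQ rQ 9 ;;
  .add rE rE rQ ;;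
  .const rFlag 0 ;;
  .loop rQ rE
    (.load rV 0 rQ ;;
     .load rC aUsed rV ;;
     .add rC rC 9 ;;
     .store aUsed rV rC ;;
     .ite 9 rC (.const rFlag 1) .skip ;;
     .add rQ rQ 9)

/-- Subtracts the current term of the current clause from the multiplicities, and goes on to the
next one. -/
def removeTerm : Program :=
  .load rQ aTerm rDepth ;;
  .load rE 0 rQ ;;
  .add rQ rQ 9 ;;
  .add rE rE rQ ;;
  .store aTerm rDepth rE ;;
  .load rC aLeft rDepth ;;
  .sub rC rC 9 ;;
  .store aLeft rDepth rC ;;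
  .loop rQ rE
    (.load rV 0 rQ ;;
     .load rC aUsed rV ;;
     .sub rC rC 9 ;;
     .store aUsed rV rC ;;
     .add rQ rQ 9)

/-- One step through the choices of terms. -/
def advance : Program :=
  .load rC aLeft rDepth ;;
  .ite 8 rC
    (.ite rDepth 1
      (addTerm ;;
       .ite 8 rFlag
        removeTerm
        (.add rDepth rDepth 9 ;;
         .load rQ aStart rDepth ;;
         .load rC 0 rQ ;;
         .store aLeft rDepth rC ;;
         .add rQ rQ 9 ;;
         .store aTerm rDepth rQ))
      (saturate ;;
       .ite 8 rOk
        (.const rRun 0 ;;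
         .const 0 1)
        (.store aLeft rDepth 8)))
    (.ite 8 rDepth
      (.sub rDepth rDepth 9 ;;
       removeTerm)
      (.const rRun 0))

/-! ### Adding and removing a term -/

section

/-- What holds throughout the loop over the choices of terms. -/
structure Environment (W : ℕ) (G : Incidence) (L N s k : ℕ) (cs : ℕ → ℕ) (M : Memory) :
    Prop where
  setting : Setting W { G with used := M.arr aUsed } L N s M
  k_eq : M.reg 1 = k
  cs_eq : M.arr aStart = cs
  k_lt : k < W
  N_lt : N + 1 < W
  m_le : G.m ≤ L * L
  m_pos : 0 < G.m

variable {W : ℕ} {G : Incidence} {L N s k : ℕ} {cs : ℕ → ℕ} {M M' : Memory}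

/-- The forbidden variables are read off the memory itself, so the multiplicities may change freely
here, and only arrays below 4 need to be preserved. -/
theorem Environment.of_agree (h : Environment W G L N s k cs M) (h' : Agree 10 4 M M') :
    Environment W G L N s k cs M' where
  setting := { h.setting with
    var_eq := by rw [h'.2 _ (by norm_num), h.setting.var_eq]
    st_eq := by rw [h'.2 _ (by norm_num), h.setting.st_eq]
    en_eq := by rw [h'.2 _ (by norm_num), h.setting.en_eq]
    used_eq := rfl
    m_eq := by rw [h'.1 _ (by norm_num), h.setting.m_eq]
    N_eq := by rw [h'.1 _ (by norm_num), h.setting.N_eq]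
    s_eq := by rw [h'.1 _ (by norm_num), h.setting.s_eq]
    L_eq := by rw [h'.1 _ (by norm_num), h.setting.L_eq]
    zero := by rw [h'.1 _ (by norm_num), h.setting.zero]
    one := by rw [h'.1 _ (by norm_num), h.setting.one] }
  k_eq := by rw [h'.1 _ (by norm_num), h.k_eq]
  cs_eq := by rw [h'.2 _ (by norm_num), h.cs_eq]
  k_lt := h.k_lt
  N_lt := h.N_lt
  m_le := h.m_le
  m_pos := h.m_pos

/-- Multiplicities only grow along the word, so the test at the last occurrence of a variable sees
its final multiplicity. The flag can therefore be described by final values alone. -/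
theorem ends_addTerm_loop {X : List ℕ} {q : ℕ} (h : Environment W G L N s k cs M)
    (hq : M.reg rQ = q) (hE : M.reg rE = q + X.length) (hN : q + X.length ≤ N)
    (hX : VarsAt G.var q X) (hu : ∀ v, M.arr aUsed v + X.length < W) :
    Ends W (.loop rQ rE
      (.load rV 0 rQ ;;
       .load rC aUsed rV ;;
       .add rC rC 9 ;;
       .store aUsed rV rC ;;
       .ite 9 rC (.const rFlag 1) .skip ;;
       .add rQ rQ 9)) M fun M' T => Agree 10 6 M M' ∧ M'.reg rDepth = M.reg rDepth ∧
        M'.reg rRun = M.reg rRun ∧ (M'.arr aUsed = fun v => M.arr aUsed v + X.count v) ∧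
        (0 < M'.reg rFlag ↔ 0 < M.reg rFlag ∨ ∃ v ∈ X, 1 < M'.arr aUsed v) ∧
        T ≤ 8 * X.length + 1 := by
  induction X generalizing M q with
  | nil => exact ends_loop_of_le (by simp [hq, hE]) (by simp [Agree.refl])
  | cons x X ih =>
    obtain ⟨hx, hX⟩ := hX
    have hS := h.setting
    have hvar := hS.var_eq
    have hNW := h.N_lt
    have hux := hu x
    simp only [List.length_cons] at *
    have key : ∀ M₁ T₁, Agree 10 6 M M₁ → M₁.reg rDepth = M.reg rDepth →
        M₁.reg rRun = M.reg rRun → M₁.reg rQ = q + 1 → M₁.reg rE = q + 1 + X.length →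
        M₁.arr aUsed = Function.update (M.arr aUsed) x (M.arr aUsed x + 1) →
        (0 < M₁.reg rFlag ↔ 0 < M.reg rFlag ∨ 1 < M.arr aUsed x + 1) → T₁ ≤ 7 →
        Ends W (.loop rQ rE
          (.load rV 0 rQ ;;
           .load rC aUsed rV ;;
           .add rC rC 9 ;;
           .store aUsed rV rC ;;
           .ite 9 rC (.const rFlag 1) .skip ;;
           .add rQ rQ 9)) M₁ fun M' T => Agree 10 6 M M' ∧ M'.reg rDepth = M.reg rDepth ∧
            M'.reg rRun = M.reg rRun ∧
            (M'.arr aUsed = fun v => M.arr aUsed v + (x :: X).count v) ∧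
            (0 < M'.reg rFlag ↔ 0 < M.reg rFlag ∨ ∃ v ∈ x :: X, 1 < M'.arr aUsed v) ∧
            T₁ + T + 1 ≤ 8 * (X.length + 1) + 1 := by
      intro M₁ T₁ hA hD hR hq₁ hE₁ hu₁ hf₁ hT₁
      refine (ih (h.of_agree (hA.mono le_rfl (by norm_num))) hq₁ hE₁
        (by omega) hX fun v => ?_).mono ?_
      · have := hu v
        rw [hu₁, Function.update_apply]
        split_ifs <;> subst_vars <;> omega
      · rintro M₂ T₂ ⟨hA₂, hD₂, hR₂, hu₂, hf₂, hT₂⟩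
        have e : M₂.arr aUsed = fun v => M.arr aUsed v + (x :: X).count v := by
          rw [hu₂, hu₁]
          ext v
          rw [Function.update_apply, List.count_cons]
          by_cases hv : v = x
          · subst hv; simp; omega
          · simp [hv, Ne.symm hv]
        refine ⟨hA.trans hA₂, hD₂.trans hD, hR₂.trans hR, e, ?_, by omega⟩
        rw [hf₂, hf₁, e, or_assoc]
        refine or_congr_right ?_
        simp only [List.mem_cons, exists_eq_or_imp]
        -- If `x` occurs again, the test at a later occurrence subsumes the present one.
        by_cases hxX : x ∈ X
        · have := List.count_pos_iff.2 hxX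
          simp only [List.count_cons_self]
          constructor
          · rintro (h | h)
            · exact .inl (by omega)
            · exact .inr h
          · rintro (h | h)
            · exact .inr ⟨x, hxX, by simp; omega⟩
            · exact .inr h
        · simp [List.count_eq_zero_of_not_mem hxX]
    refine ends_loop_of_lt (by omega) ?_
    simp [ends_seq, ends_ite, hq, hvar, hS.one, hx]
    refine ⟨by omega, fun hlt => ⟨by omega, by omega, ?_⟩, fun hlt => ⟨by omega, ?_⟩⟩
    · refine (key _ 7 ?_ ?_ ?_ ?_ ?_ ?_ ?_ le_rfl).mono fun M' T h' => by simpa using h'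
      all_goals simp [Agree.refl, hE]
      all_goals omega
    · refine (key _ 7 ?_ ?_ ?_ ?_ ?_ ?_ ?_ le_rfl).mono fun M' T h' => by simpa using h'
      all_goals simp [Agree.refl, hE]
      all_goals omega

theorem ends_addTerm {X : List ℕ} {p : ℕ} (h : Environment W G L N s k cs M)
    (hp : M.arr aTerm (M.reg rDepth) = p) (hX : G.var p = X.length) (hX' : VarsAt G.var (p + 1) X)
    (hN : p + 1 + X.length ≤ N) (hu : ∀ v, M.arr aUsed v ≤ 1) :
    Ends W addTerm M fun M' T => Agree 10 6 M M' ∧ M'.reg rDepth = M.reg rDepth ∧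
        M'.reg rRun = M.reg rRun ∧ (M'.arr aUsed = fun v => M.arr aUsed v + X.count v) ∧
        (0 < M'.reg rFlag ↔ ∃ v ∈ X, 1 < M.arr aUsed v + X.count v) ∧
        T ≤ 8 * X.length + 6 := by
  have hS := h.setting
  have hvar := hS.var_eq
  have hNW := h.N_lt
  simp only [addTerm, ends_seq, ends_const, ends_add, ends_load]
  simp [hS.one, hp, hvar, hX]
  refine ⟨by omega, by omega, ?_⟩
  refine Ends.mono (ends_addTerm_loop (h.of_agree ?_) ?_ ?_ hN hX' fun v => ?_) ?_
  · simp [Agree.refl]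
  · simp
  · simp
    omega
  · have := hu v
    simp
    omega
  · rintro M' T ⟨hA, hD, hR, hu', hf, hT⟩
    simp only [hu'] at hf
    simp at hD hR hu' hf
    exact ⟨.trans (by simp [Agree.refl]) hA, hD, hR, hu', hf, by omega⟩

theorem ends_removeTerm_loop {X : List ℕ} {q : ℕ} (h : Environment W G L N s k cs M)
    (hq : M.reg rQ = q) (hE : M.reg rE = q + X.length) (hN : q + X.length ≤ N)
    (hX : VarsAt G.var q X) :
    Ends W (.loop rQ rE
      (.load rV 0 rQ ;;
       .load rC aUsed rV ;;
       .sub rC rC 9 ;;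
       .store aUsed rV rC ;;
       .add rQ rQ 9)) M fun M' T => Agree 10 6 M M' ∧ M'.reg rDepth = M.reg rDepth ∧
        M'.reg rRun = M.reg rRun ∧ (M'.arr aUsed = fun v => M.arr aUsed v - X.count v) ∧
        T ≤ 6 * X.length + 1 := by
  induction X generalizing M q with
  | nil => exact ends_loop_of_le (by simp [hq, hE]) (by simp [Agree.refl])
  | cons x X ih =>
    obtain ⟨hx, hX⟩ := hX
    have hS := h.setting
    have hvar := hS.var_eq
    have hNW := h.N_lt
    simp only [List.length_cons] at *
    refine ends_loop_of_lt (by omega) ?_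
    simp [ends_seq, hq, hvar, hS.one, hx]
    refine ⟨by omega, ?_⟩
    refine (ih (h.of_agree (by simp [Agree.refl])) (by simp) (by simp [hE]; omega)
      (by omega) hX).mono ?_
    rintro M₂ T₂ ⟨hA₂, hD₂, hR₂, hu₂, hT₂⟩
    simp at hD₂ hR₂ hu₂
    refine ⟨.trans (by simp [Agree.refl]) hA₂, hD₂, hR₂, ?_, by omega⟩
    rw [hu₂]
    ext v
    rw [Function.update_apply, List.count_cons]
    by_cases hv : v = x
    · subst hv; simp; omega
    · simp [hv, Ne.symm hv]

theorem ends_removeTerm {X : List ℕ} {p : ℕ} (h : Environment W G L N s k cs M)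
    (hp : M.arr aTerm (M.reg rDepth) = p) (hX : G.var p = X.length) (hX' : VarsAt G.var (p + 1) X)
    (hN : p + 1 + X.length ≤ N) :
    Ends W removeTerm M fun M' T => Agree 10 4 M M' ∧ M'.reg rDepth = M.reg rDepth ∧
        M'.reg rRun = M.reg rRun ∧
        M'.arr aTerm = Function.update (M.arr aTerm) (M.reg rDepth) (p + 1 + X.length) ∧
        M'.arr aLeft = Function.update (M.arr aLeft) (M.reg rDepth)
          (M.arr aLeft (M.reg rDepth) - 1) ∧
        (M'.arr aUsed = fun v => M.arr aUsed v - X.count v) ∧ T ≤ 6 * X.length + 9 := by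
  have hS := h.setting
  have hvar := hS.var_eq
  have hNW := h.N_lt
  have hl : X.length + (p + 1) = p + 1 + X.length := by omega
  simp only [removeTerm, ends_seq, ends_sub, ends_add, ends_load, ends_store]
  simp [hS.one, hp, hvar, hX, hl]
  refine ⟨by omega, by omega, ?_⟩
  refine (ends_removeTerm_loop (h.of_agree (by simp [Agree.refl])) (by simp) (by simp) hN
    hX').mono ?_
  rintro M' T ⟨hA, hD, hR, hu', hT⟩
  have h4 := hA.2 4 (by norm_num)
  have h5 := hA.2 5 (by norm_num)
  simp at hD hR hu' h4 h5
  exact ⟨.trans (by simp [Agree.refl]) (hA.mono le_rfl (by norm_num)), hD, hR, h4, h5, hu',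
    by omega⟩

end

/-! ### Correctness and cost of the exploration -/

section

variable {W : ℕ} {G : Incidence} {L N s k : ℕ} {cs : ℕ → ℕ} {M M' : Memory}

/-- One can choose a term from every clause of `f`, and a variable from every clause of `G`, such
that no variable occurs twice when its multiplicity in `u` is added. -/
def Choosable (G : Incidence) : List (List (List ℕ)) → (ℕ → ℕ) → Prop
  | [], u => ({ G with used := u } : Incidence).Saturable
  | F :: f, u => ∃ X ∈ F, (∀ v ∈ X, u v + X.count v ≤ 1) ∧
      Choosable G f fun v => u v + X.count v

/-- A bound for the time in which the choices of terms from the clauses `f` are explored, if this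
takes time `b` for every term and time `l` for every choice. -/
def exploreCost (b l : ℕ) : List (List (List ℕ)) → ℕ
  | [] => l
  | F :: f => F.length * (b + exploreCost b l f)

/-- The situation after the choices of terms from clause `i` on have been explored: either a good
one has been found, or there is none and the search returns to clause `i`. -/
def Explored (i : ℕ) (good : Prop) (M M' : Memory) : Prop :=
  (M'.reg rRun = 0 ∧ M'.reg 0 = 1 ∧ good) ∨
  (¬ good ∧ Agree 10 4 M M' ∧ M'.reg rDepth = i ∧ M'.reg rRun = 1 ∧ M'.arr aLeft i = 0 ∧
    M'.arr aUsed = M.arr aUsed ∧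
    ∀ j < i, M'.arr aTerm j = M.arr aTerm j ∧ M'.arr aLeft j = M.arr aLeft j)

/-- Depth `k` is entered like a clause: the word found there is the number of clauses of `g`, which
is positive and serves as the number of terms left. A failed test sets it to zero, so the next step
backtracks as from an exhausted clause. -/
theorem reach_leaf {b : ℕ} (h : Environment W G L N s k cs M) (hD : M.reg rDepth = k)
    (hR : M.reg rRun = 1) (hl : 0 < M.arr aLeft k) :
    Reach W 8 rRun advance M fun M' T =>
      Explored k (Choosable G [] (M.arr aUsed)) M M' ∧
        T ≤ exploreCost b (200 * (L * G.size) + 10) [] := by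
  have hS := h.setting
  have := h.N_lt
  refine Reach.step (by simp [hS.zero, hR]) ?_
  rw [advance, ends_seq, ends_load, ends_ite, ends_ite]
  simp only [Memory.reg_setReg, hS.zero, hD, h.k_eq]
  simp only [hl, hl.not_ge, lt_irrefl, le_refl, false_imp_iff, true_and, true_imp_iff,
    Nat.reduceEqDiff, if_false, if_true, and_true]
  rw [ends_seq]
  have hA₀ : Agree 13 10 M (M.setReg rC (M.arr aLeft k)) := by simp [Agree.refl]
  have h₁ := h.of_agree (hA₀.mono (by norm_num) (by norm_num))
  refine (ends_saturate h₁.setting h.m_le h.m_pos).mono ?_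
  rintro M₁ T₁ ⟨hA₁, hok, hok', hT₁⟩
  have hA : Agree 13 10 M M₁ := hA₀.trans (hA₁.mono (by norm_num) le_rfl)
  have hS₁ := (h.of_agree (hA.mono (by norm_num) (by norm_num))).setting
  have hD₁ : M₁.reg rDepth = k := by rw [hA₁.1 _ (by norm_num)]; simpa
  have hR₁ : M₁.reg rRun = 1 := by rw [hA₁.1 _ (by norm_num)]; simpa
  have hok : M₁.reg rOk = 1 ↔ Choosable G [] (M.arr aUsed) := hok
  have hT₁ : T₁ ≤ 200 * (L * G.size) := hT₁
  simp [ends_ite, hS₁.zero, ends_seq]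
  constructor
  · intro hpos
    refine ⟨by omega, Reach.done ⟨.inl ?_, ?_⟩⟩
    · simp
      exact hok.1 (by omega)
    · simp [exploreCost]; omega
  · intro hz
    refine Reach.done ⟨.inr ⟨fun h' => ?_, ?_, ?_⟩, ?_⟩
    · have := hok.2 h'; omega
    · simpa using hA.mono (by norm_num) (by norm_num)
    · simp [hD₁, hR₁, hA.2 6 (by norm_num), hA.2 4 (by norm_num), hA.2 5 (by norm_num)]
      intro j hj
      simp [hj.ne]
    · simp [exploreCost]; omega

/-- Induction on the terms left at depth `i`, with the exploration of the later clauses as the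
hypothesis `hf`. Adding a term takes at most `8 * t + 6` steps and removing it `6 * t + 9`; the rest
of `b` covers the overhead. -/
theorem reach_terms {b l i t p : ℕ} {f : List (List (List ℕ))} {F : List (List ℕ)}
    (hb : 14 * t + 50 ≤ b)
    (hf : ∀ M, Environment W G L N s k cs M → M.reg rDepth = i + 1 → M.reg rRun = 1 →
      M.arr aTerm (i + 1) = cs (i + 1) + 1 → M.arr aLeft (i + 1) = G.var (cs (i + 1)) →
      (∀ v, M.arr aUsed v ≤ 1) → Reach W 8 rRun advance M fun M' T =>
        Explored (i + 1) (Choosable G f (M.arr aUsed)) M M' ∧ T ≤ exploreCost b l f)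
    (hik : i < k) (hcs : cs (i + 1) < N)
    (h : Environment W G L N s k cs M) (hD : M.reg rDepth = i) (hR : M.reg rRun = 1)
    (hp : M.arr aTerm i = p) (hl : M.arr aLeft i = F.length) (hF : TermsAt G.var N p F)
    (hu : ∀ v, M.arr aUsed v ≤ 1) (ht : ∀ X ∈ F, X.length ≤ t) :
    Reach W 8 rRun advance M fun M' T =>
      Explored i (Choosable G (F :: f) (M.arr aUsed)) M M' ∧ T ≤ exploreCost b l (F :: f) := by
  induction F generalizing M p with
  | nil =>
    refine Reach.done ⟨.inr ⟨by simp [Choosable], .refl M, hD, hR, hl, rfl, fun _ _ => ⟨rfl,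
      rfl⟩⟩, ?_⟩
    simp
  | cons X F ih =>
    obtain ⟨hX, hXv, hXN, hF⟩ := hF
    have hS := h.setting
    have := h.N_lt
    have := h.k_lt
    have hXt := ht X (by simp)
    have hcost : exploreCost b l ((X :: F) :: f) = exploreCost b l
      (F :: f) + b + exploreCost b l f := by
      simp [exploreCost]; ring
    have hch : Choosable G ((X :: F) :: f) (M.arr aUsed) ↔
        ((∀ v ∈ X, M.arr aUsed v + X.count v ≤ 1) ∧
          Choosable G f fun v => M.arr aUsed v + X.count v) ∨ Choosable G (F :: f)
          (M.arr aUsed) := by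
      simp [Choosable]
    -- the remaining terms, after the first one has turned out to be useless
    have next : ∀ M₁ T₁, Agree 10 4 M M₁ → M₁.reg rDepth = i → M₁.reg rRun = 1 →
        M₁.arr aTerm i = p + 1 + X.length → M₁.arr aLeft i = F.length →
        M₁.arr aUsed = M.arr aUsed →
        (∀ j < i, M₁.arr aTerm j = M.arr aTerm j ∧ M₁.arr aLeft j = M.arr aLeft j) →
        T₁ ≤ b + exploreCost b l f →
        ¬ ((∀ v ∈ X, M.arr aUsed v + X.count v ≤ 1) ∧
          Choosable G f fun v => M.arr aUsed v + X.count v) →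
        Reach W 8 rRun advance M₁ fun M' T =>
          Explored i (Choosable G ((X :: F) :: f) (M.arr aUsed)) M M' ∧
            T₁ + T ≤ exploreCost b l ((X :: F) :: f) := by
      intro M₁ T₁ hA₁ hD₁ hR₁ hp₁ hl₁ hu₁ hj₁ hT₁ hno
      refine (ih (h.of_agree hA₁) hD₁ hR₁ hp₁ hl₁ hF (by rwa [hu₁]) fun Y hY =>
        ht Y (List.mem_cons_of_mem _ hY)).mono ?_
      rintro M₂ T₂ ⟨hE, hT₂⟩
      refine ⟨?_, by omega⟩
      rw [hu₁] at hE
      rw [hch]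
      rcases hE with ⟨h1, h2, h3⟩ | ⟨h1, h2, h3, h4, h5, h6, h7⟩
      · exact .inl ⟨h1, h2, .inr h3⟩
      · refine .inr ⟨by tauto, hA₁.trans h2, h3, h4, h5, h6.trans hu₁, fun j hj => ?_⟩
        exact ⟨(h7 j hj).1.trans (hj₁ j hj).1, (h7 j hj).2.trans (hj₁ j hj).2⟩
    refine Reach.step (by simp [hS.zero, hR]) ?_
    rw [advance, ends_seq, ends_load, ends_ite, ends_ite]
    simp only [Memory.reg_setReg, hS.zero, hD, h.k_eq]
    simp only [hl, List.length_cons, Nat.succ_pos, hik, hik.not_ge, false_imp_iff,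
      true_imp_iff, Nat.reduceEqDiff, if_false, if_true, and_true, ends_seq]
    refine ⟨?_, fun h' => absurd h' (by omega)⟩
    have hA₀ : Agree 13 10 M (M.setReg rC (F.length + 1)) := by simp [Agree.refl]
    have h₀ := h.of_agree (hA₀.mono (by norm_num) (by norm_num))
    refine (ends_addTerm h₀ (p := p) (by simpa [hD]) hX hXv hXN (by simpa using hu)).mono ?_
    rintro M₁ T₁ ⟨hA₁, hD₁, hR₁, hu₁, hf₁, hT₁⟩
    have hA₁' : Agree 10 6 M M₁ := (hA₀.mono (by norm_num) (by norm_num)).trans hA₁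
    simp [hD, hR] at hD₁ hR₁ hu₁ hf₁
    have h₁ := h.of_agree (hA₁'.mono le_rfl (by norm_num))
    have e4 := hA₁'.2 4 (by norm_num)
    have e5 := hA₁'.2 5 (by norm_num)
    rw [ends_ite]
    rw [h₁.setting.zero]
    constructor
    · intro hflag
      refine (ends_removeTerm h₁ (p := p) (by rw [hD₁, e4, hp]) hX hXv hXN).mono ?_
      rintro M₂ T₂ ⟨hA₂, hD₂, hR₂, h4, h5, h6, hT₂⟩
      refine (next M₂ (1 + (T₁ + (T₂ + 1) + 1 + 1) + 1) ((hA₁'.mono le_rfl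
        (by norm_num)).trans hA₂) (hD₂.trans hD₁)
        (hR₂.trans hR₁) (by simp [h4, hD₁]) (by simp [h5, hD₁, e5, hl])
        (by rw [h6, hu₁]; simp) (fun j hj => ?_) (by omega) ?_).mono ?_
      · simp [h4, h5, hD₁, e4, e5, hj.ne]
      · rintro ⟨h', -⟩
        obtain ⟨v, hv, hv'⟩ := hf₁.1 hflag
        exact absurd (h' v hv) (by omega)
      · rintro M₃ T₃ ⟨hE, hT⟩
        exact ⟨hE, by omega⟩
    · intro hflag
      -- The flag is not set, so the multiplicities stay at most one, as the exploration of the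
      -- later clauses requires.
      have hok : ∀ v ∈ X, M.arr aUsed v + X.count v ≤ 1 := by
        by_contra! hcon
        have := hf₁.2 hcon
        omega
      have hvar := h₁.setting.var_eq
      simp only at hvar
      simp [ends_seq, h₁.setting.one, hD₁, h₁.cs_eq, hvar]
      refine ⟨by omega, by omega, ?_⟩
      refine Reach.trans (hf _ (h₁.of_agree (by simp [Agree.refl])) (by simp) (by simpa)
        (by simp) (by simp) fun v => ?_) ?_
      · simp [hu₁]
        by_cases hv : v ∈ X
        · exact hok v hv
        · simpa [List.count_eq_zero_of_not_mem hv] using hu v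
      rintro M₂ T₂ ⟨hE, hT₂⟩
      simp [Explored, hu₁] at hE
      rcases hE with ⟨hR₂, h0, hgood⟩ | ⟨hno, hA₂, hD₂, hR₂, hl₂, hu₂, hj₂⟩
      · refine Reach.done ⟨.inl ⟨hR₂, h0, hch.2 (.inl ⟨hok, hgood⟩)⟩, by omega⟩
      · have hA₂' : Agree 10 4 M M₂ :=
          (hA₁'.mono le_rfl (by norm_num)).trans (.trans (by simp [Agree.refl]) hA₂)
        have h₂ := h.of_agree hA₂'
        obtain ⟨hj4, hj5⟩ := hj₂ i (by omega)
        simp at hj4 hj5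
        -- One more iteration leaves the exhausted depth `i + 1` and takes back the term chosen at
        -- depth `i`.
        refine Reach.step (by simp [h₂.setting.zero, hR₂]) ?_
        rw [ends_seq, ends_load, ends_ite, ends_ite]
        simp only [Memory.reg_setReg, h₂.setting.zero, hD₂]
        simp only [hD₂, hl₂, lt_irrefl, le_refl, Nat.succ_pos, false_imp_iff,
          true_imp_iff, true_and, Nat.reduceEqDiff, if_false, if_true, ends_ite, ends_seq, ends_sub,
          Memory.reg_setReg, h₂.setting.one, h₂.setting.zero]
        refine ⟨?_, fun h' => absurd h' (by omega)⟩
        refine Ends.mono (ends_removeTerm (X := X) (p := p) (h₂.of_agree ?_) ?_ hX hXv hXN) ?_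
        · simp [Agree.refl]
        · simp [hj4, e4, hp]
        rintro M₃ T₃ ⟨hA₃, hD₃, hR₃, h4, h5, h6, hT₃⟩
        simp at hD₃ hR₃ h4 h5 h6
        refine (next M₃ (T₁ + T₂ + T₃ + 16) (hA₂'.trans (.trans (by simp [Agree.refl]) hA₃)) hD₃
          (hR₃.trans hR₂) (by simp [h4]) (by simp [h5, hj5, e5, hl])
          (by rw [h6, hu₂]; simp) (fun j hj => ?_) (by omega) (fun h' => hno h'.2)).mono ?_
        · have := hj₂ j (by omega)
          simp [(show j ≠ i + 1 by omega)] at this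
          simp [h4, h5, e4, e5, hj.ne, this]
        · rintro M₄ T₄ ⟨hE, hT⟩
          exact ⟨hE, by omega⟩

theorem reach_clauses {b i t : ℕ} {f : List (List (List ℕ))} (hb : 14 * t + 50 ≤ b)
    (hf : ClausesAt G.var N cs k i f) (ht : ∀ F ∈ f, ∀ X ∈ F, X.length ≤ t)
    (h : Environment W G L N s k cs M) (hD : M.reg rDepth = i) (hR : M.reg rRun = 1)
    (hp : M.arr aTerm i = cs i + 1) (hl : M.arr aLeft i = G.var (cs i))
    (hu : ∀ v, M.arr aUsed v ≤ 1) :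
    Reach W 8 rRun advance M fun M' T => Explored i (Choosable G f (M.arr aUsed)) M M' ∧
      T ≤ exploreCost b (200 * (L * G.size) + 10) f := by
  induction f generalizing M i with
  | nil =>
    obtain ⟨rfl, h0, -⟩ := hf
    exact reach_leaf h hD hR (by omega)
  | cons F f ih =>
    obtain ⟨hik, hlen, -, hF, hf⟩ := hf
    refine reach_terms hb (fun M h hD hR hp hl hu => ?_) hik ?_ h hD hR hp (hl.trans hlen) hF hu
      (ht F (by simp))
    · exact ih hf (fun F' hF' => ht F' (List.mem_cons_of_mem _ hF')) h hD hR hp hl hu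
    · cases f with
      | nil => exact hf.2.2
      | cons => exact hf.2.2.1

/-- Decides whether there is a good choice of terms. -/
def explore : Program :=
  .const rRun 1 ;;
  .const rDepth 0 ;;
  .load rQ aStart rDepth ;;
  .load rC 0 rQ ;;
  .store aLeft rDepth rC ;;
  .add rQ rQ 9 ;;
  .store aTerm rDepth rQ ;;
  .loop 8 rRun advance

theorem ends_explore {b t : ℕ} {f : List (List (List ℕ))} (hb : 14 * t + 50 ≤ b)
    (hf : ClausesAt G.var N cs k 0 f) (ht : ∀ F ∈ f, ∀ X ∈ F, X.length ≤ t)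
    (h : Environment W G L N s k cs M) (h0 : M.reg 0 = 0) (hu : ∀ v, M.arr aUsed v = 0) :
    Ends W explore M fun M' T => (M'.reg 0 = 1 ↔ Choosable G f fun _ => 0) ∧
      T ≤ exploreCost b (200 * (L * G.size) + 10) f + 15 := by
  have := h.N_lt
  have hu' : M.arr aUsed = fun _ => 0 := funext hu
  have hvar := h.setting.var_eq
  simp only at hvar
  have hcs : cs 0 < N := by
    cases f with
    | nil => exact hf.2.2
    | cons => exact hf.2.2.1
  simp [explore, ends_seq, h.setting.one, h.cs_eq, hvar]
  refine ⟨by omega, by omega, ?_⟩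
  refine reach_clauses (i := 0) hb hf ht (h.of_agree ?_) ?_ ?_ ?_ ?_ ?_ _ ?_
  · simp [Agree.refl]
  · simp
  · simp
  · simp
  · simp
  · simp [hu]
  rintro M₁ T₁ ⟨hE, hT₁⟩
  simp [Explored, hu'] at hE
  rcases hE with ⟨hR, h01, hgood⟩ | ⟨hno, hA, hD, hR, hl, -⟩
  · exact ends_loop_of_le (by omega) ⟨iff_of_true h01 hgood, by omega⟩
  · have h₁ := h.of_agree (.trans (by simp [Agree.refl]) hA)
    -- A last iteration, at depth zero with no terms left, stops the loop; the answer register still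
    -- has its initial value `0`.
    refine ends_loop_of_lt (by simp [h₁.setting.zero, hR]) ?_
    simp [advance, ends_seq, ends_ite, hl, hD, h₁.setting.zero]
    refine ends_loop_of_le (by simp) ?_
    have := hA.1 0 (by norm_num)
    simp [h0] at this
    simp [this, hno]
    omega

end

/-! ### The meaning of the result -/

theorem termMonomial_apply {n : ℕ} (X : List (Fin n)) (i : Fin n) :
    termMonomial X i = X.count i := by
  induction X with
  | nil => simp [termMonomial]
  | cons x X ih =>
    have : termMonomial (x :: X) = Finsupp.single x 1 + termMonomial X := by simp [termMonomial]
    rw [this, Finsupp.add_apply, ih, List.count_cons, Finsupp.single_apply, add_comm]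
    simp

theorem mem_sumProductExpansion_cons {n : ℕ} {F : List (List (Fin n))} {f : PiSigmaPi n}
    {d : Fin n →₀ ℕ} : d ∈ sumProductExpansion (F :: f) ↔
      ∃ X ∈ F, ∃ d' ∈ sumProductExpansion f, termMonomial X + d' = d := by
  simp [sumProductExpansion]

theorem mem_sumProductExpansion_toPiSigmaPi {n : ℕ} {g : PiSigma n} {d : Fin n →₀ ℕ} :
    d ∈ sumProductExpansion g.toPiSigmaPi ↔
      ∃ Y : List (Fin n), List.Forall₂ (· ∈ ·) Y g ∧ d = termMonomial Y := by
  induction g generalizing d with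
  | nil => simp [PiSigma.toPiSigmaPi, sumProductExpansion, termMonomial]
  | cons H g ih =>
    have h : PiSigma.toPiSigmaPi (H :: g) = (H.map fun x => [x]) :: PiSigma.toPiSigmaPi g := rfl
    rw [h, mem_sumProductExpansion_cons]
    constructor
    · rintro ⟨X, hX, d', hd', rfl⟩
      obtain ⟨x, hx, rfl⟩ := List.mem_map.1 hX
      obtain ⟨Y, hY, rfl⟩ := ih.1 hd'
      exact ⟨x :: Y, .cons hx hY, by simp [termMonomial]⟩
    · rintro ⟨_, hY, rfl⟩
      cases hY with
      | @cons x _ Y _ hx hY =>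
        exact ⟨[x], List.mem_map.2 ⟨x, hx, rfl⟩, _, ih.2 ⟨Y, hY, rfl⟩, by simp [termMonomial]⟩

/-- The clauses of `G` are those of `g`. -/
structure Represents (G : Incidence) {n : ℕ} (g : PiSigma n) : Prop where
  m_eq : G.m = g.length
  adj_iff : ∀ u (hu : u < g.length) v, G.Adj u v ↔ v ∈ g[u].map Fin.val

/-- For multilinear `e`, the exponents of `e + d` are at most one exactly when the variables chosen
for `d` are distinct and avoid those of `e`. -/
theorem Represents.saturable_iff {G : Incidence} {n : ℕ} {g : PiSigma n} (h : Represents G g)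
    {e : Fin n →₀ ℕ} (he : IsMultilinear e) (hu : ∀ x : Fin n, G.used x = e x) :
    G.Saturable ↔ ∃ d ∈ sumProductExpansion g.toPiSigmaPi, IsMultilinear (e + d) := by
  constructor
  · rintro ⟨σ, hσ, hinj⟩
    have hex : ∀ u (hu : u < g.length), ∃ x ∈ g[u], (x : ℕ) = σ u := fun u hu => by
      simpa using (h.adj_iff u hu _).1 (hσ u (h.m_eq ▸ hu)).1
    choose τ hτ hτσ using hex
    set Y := List.ofFn fun u : Fin g.length => τ u u.2 with hY
    refine ⟨termMonomial Y, mem_sumProductExpansion_toPiSigmaPi.2 ⟨Y, ?_, rfl⟩, fun i => ?_⟩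
    · rw [List.forall₂_iff_get]
      refine ⟨by simp [hY], fun i h₁ h₂ => ?_⟩
      simp [hY, hτ]
    · rw [Finsupp.add_apply, termMonomial_apply]
      have hnd : Y.Nodup := by
        rw [hY, List.nodup_ofFn]
        intro u u' e
        have : σ u = σ u' := by rw [← hτσ u u.2, ← hτσ u' u'.2, show τ u u.2 = τ u' u'.2 from e]
        exact Fin.ext (hinj (by simp [h.m_eq]) (by simp [h.m_eq]) this)
      have hc := List.nodup_iff_count_le_one.1 hnd i
      by_cases hi : i ∈ Y
      · obtain ⟨u, rfl⟩ := List.mem_ofFn.1 hi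
        have := (hσ u (by simp [h.m_eq])).2
        rw [← hτσ u u.2, hu] at this
        omega
      · have := he i
        rw [List.count_eq_zero_of_not_mem hi]
        omega
  · rintro ⟨d, hd, hm⟩
    obtain ⟨Y, hY, rfl⟩ := mem_sumProductExpansion_toPiSigmaPi.1 hd
    have hm : ∀ i, e i + Y.count i ≤ 1 := fun i => by simpa [termMonomial_apply] using hm i
    have hlen := hY.length_eq
    have hnd : Y.Nodup := List.nodup_iff_count_le_one.2 fun i => by have := hm i; omega
    refine ⟨fun u => if hu : u < Y.length then (Y[u] : ℕ) else 0, fun u hu' => ?_, ?_⟩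
    · have huY : u < Y.length := by rw [hlen, ← h.m_eq]; exact hu'
      simp only [huY, dite_true]
      refine ⟨(h.adj_iff u (hlen ▸ huY) _).2 (List.mem_map_of_mem ?_), ?_⟩
      · exact (List.forall₂_iff_get.1 hY).2 u huY (hlen ▸ huY)
      · have := List.count_pos_iff.2 (List.getElem_mem huY)
        have := hm Y[u]
        rw [hu]
        omega
    · intro u hu u' hu' e
      have huY : u < Y.length := by rw [hlen, ← h.m_eq]; exact hu
      have huY' : u' < Y.length := by rw [hlen, ← h.m_eq]; exact hu'
      simp only [huY, huY', dite_true] at e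
      exact (hnd.getElem_inj_iff).1 (Fin.ext e)

/-- The clauses, with variables as natural numbers. -/
def indices {n : ℕ} (f : PiSigmaPi n) : List (List (List ℕ)) :=
  f.map fun F => F.map fun X => X.map Fin.val

theorem choosable_iff {G : Incidence} {n : ℕ} {g : PiSigma n} (h : Represents G g)
    (f : PiSigmaPi n) {e : Fin n →₀ ℕ} {u : ℕ → ℕ} (he : IsMultilinear e)
    (hu : ∀ x : Fin n, u x = e x) :
    Choosable G (indices f) u ↔
      ∃ d ∈ sumProductExpansion (f ++ g.toPiSigmaPi), IsMultilinear (e + d) := by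
  induction f generalizing e u with
  | nil =>
    exact Represents.saturable_iff (G := { G with used := u }) ⟨h.m_eq, h.adj_iff⟩ he hu
  | cons F f ih =>
    have hcount : ∀ (X : List (Fin n)) (x : Fin n), (X.map Fin.val).count (x : ℕ) = X.count x :=
      fun X x => List.count_map_of_injective _ _ Fin.val_injective _
    have hX : ∀ X : List (Fin n), (∀ v ∈ X.map Fin.val, u v + (X.map Fin.val).count v ≤ 1) ↔
        IsMultilinear (e + termMonomial X) := by
      intro X
      simp only [List.forall_mem_map, hcount, hu, IsMultilinear, Finsupp.add_apply,
        termMonomial_apply]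
      refine ⟨fun h i => ?_, fun h i _ => h i⟩
      by_cases hi : i ∈ X
      · exact h i hi
      · rw [List.count_eq_zero_of_not_mem hi]
        exact he i
    have ih' : ∀ X : List (Fin n), IsMultilinear (e + termMonomial X) →
        (Choosable G (indices f) (fun v => u v + (X.map Fin.val).count v) ↔
          ∃ d ∈ sumProductExpansion (f ++ g.toPiSigmaPi), IsMultilinear (e + termMonomial X + d)) :=
      fun X hXm => ih hXm fun x => by simp [hcount, hu, termMonomial_apply]
    have hcons : indices (F :: f) = (F.map fun X => X.map Fin.val) :: indices f := rfl
    rw [hcons, Choosable, List.cons_append]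
    simp only [mem_sumProductExpansion_cons]
    constructor
    · rintro ⟨_, hXF, h1, h2⟩
      obtain ⟨X, hXF', rfl⟩ := List.mem_map.1 hXF
      rw [hX] at h1
      obtain ⟨d, hd, hm⟩ := (ih' X h1).1 h2
      exact ⟨_, ⟨X, hXF', d, hd, rfl⟩, by rwa [← add_assoc]⟩
    · rintro ⟨_, ⟨X, hXF, d, hd, rfl⟩, hm⟩
      rw [← add_assoc] at hm
      -- Exponents only grow when factors are added, so dropping a partial choice with a repeated
      -- variable loses nothing.
      have h1 : IsMultilinear (e + termMonomial X) := fun i => by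
        have := hm i
        rw [Finsupp.add_apply] at this
        omega
      exact ⟨_, List.mem_map_of_mem hXF, (hX X).2 h1, (ih' X h1).2 ⟨d, hd, hm⟩⟩

/-- The coefficient of `d` is the number of its occurrences in the expansion, so nothing cancels in
characteristic zero. -/
theorem mem_support_iff {n : ℕ} (f : PiSigmaPi n) (d : Fin n →₀ ℕ) :
    d ∈ (f.toPoly ℤ).support ↔ d ∈ sumProductExpansion f := by
  classical
  rw [MvPolynomial.mem_support_iff, ← sum_sumProductExpansion]
  have : ∀ l : List (Fin n →₀ ℕ), MvPolynomial.coeff d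
      ((l.map fun d => MvPolynomial.monomial d (1 : ℤ)).sum) = l.count d := by
    intro l
    induction l with
    | nil => simp
    | cons a l ih =>
      rw [List.map_cons, List.sum_cons, MvPolynomial.coeff_add, ih, MvPolynomial.coeff_monomial,
        List.count_cons]
      by_cases h : a = d <;> simp [h, add_comm]
  rw [this]
  simp [List.count_eq_zero]

theorem toPoly_append {n : ℕ} (f g : PiSigmaPi n) :
    PiSigmaPi.toPoly ℤ (f ++ g) = f.toPoly ℤ * g.toPoly ℤ := by
  simp [PiSigmaPi.toPoly]

/-! ### The input word -/

/-- The encoding of a term, or of a clause of single variables. -/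
def encodeTerm (X : List ℕ) : List ℕ := X.length :: X

/-- The encoding of the terms of a clause. -/
def encodeTerms (F : List (List ℕ)) : List ℕ := F.flatMap encodeTerm

@[simp] theorem encodeTerms_nil : encodeTerms [] = [] := rfl

@[simp] theorem encodeTerms_cons (X : List ℕ) (F : List (List ℕ)) :
    encodeTerms (X :: F) = X.length :: (X ++ encodeTerms F) := rfl

/-- The encoding of a list of clauses. -/
def encodeClauses (f : List (List (List ℕ))) : List ℕ :=
  f.flatMap fun F => F.length :: encodeTerms F

@[simp] theorem encodeClauses_nil : encodeClauses [] = [] := rfl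

@[simp] theorem encodeClauses_cons (F : List (List ℕ)) (f : List (List (List ℕ))) :
    encodeClauses (F :: f) = F.length :: (encodeTerms F ++ encodeClauses f) := rfl

theorem encodeInput_eq {n : ℕ} (f : PiSigmaPi n) (g : PiSigma n) :
    encodeInput f g = n :: (indices f).length :: (encodeClauses (indices f) ++
      g.length :: encodeTerms (g.map fun X => X.map Fin.val)) := by
  have h : encodeVars = fun X : List (Fin n) => X.length :: X.map Fin.val := funext fun X => by
    simp only [encodeVars, List.map_id', List.bind_eq_flatMap, List.pure_def]
    congr 1
    induction X <;> simp_all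
  simp [encodeInput, encodeClauses, indices, h, encodeTerms, encodeTerm, List.flatMap_map]

theorem varsAt_append {a : ℕ → ℕ} {q : ℕ} {X Y : List ℕ} :
    VarsAt a q (X ++ Y) ↔ VarsAt a q X ∧ VarsAt a (q + X.length) Y := by
  induction X generalizing q with
  | nil => simp [VarsAt]
  | cons x X ih =>
    simp only [List.cons_append, VarsAt, ih, List.length_cons, and_assoc]
    rw [show q + (X.length + 1) = q + 1 + X.length by omega]

theorem varsAt_getD (w w' : List ℕ) : VarsAt (fun i => (w' ++ w).getD i 0) w'.length w := by
  induction w generalizing w' with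
  | nil => trivial
  | cons x w ih =>
    refine ⟨by simp, ?_⟩
    have := ih (w' ++ [x])
    simpa using this

theorem VarsAt.mem_iff {a : ℕ → ℕ} {q v : ℕ} {X : List ℕ} (h : VarsAt a q X) :
    (∃ p, q ≤ p ∧ p < q + X.length ∧ a p = v) ↔ v ∈ X := by
  induction X generalizing q with
  | nil => simp; omega
  | cons x X ih =>
    obtain ⟨hx, hX⟩ := h
    rw [List.mem_cons, ← ih hX, List.length_cons]
    constructor
    · rintro ⟨p, h1, h2, h3⟩
      rcases h1.eq_or_lt with rfl | h1
      · exact .inl (h3.symm.trans hx)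
      · exact .inr ⟨p, h1, by omega, h3⟩
    · rintro (rfl | ⟨p, h1, h2, h3⟩)
      · exact ⟨q, le_rfl, by omega, hx⟩
      · exact ⟨p, by omega, by omega, h3⟩

theorem VarsAt.termsAt {a : ℕ → ℕ} {p N : ℕ} {F : List (List ℕ)}
    (h : VarsAt a p (encodeTerms F)) (hN : p + (encodeTerms F).length ≤ N) :
    TermsAt a N p F := by
  induction F generalizing p with
  | nil => trivial
  | cons X F ih =>
    simp only [encodeTerms_cons, List.length_cons, List.length_append] at h hN
    obtain ⟨h1, h2⟩ := h
    rw [varsAt_append] at h2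
    exact ⟨h1, h2.1, by omega, ih h2.2 (by omega)⟩

/-! ### Reading the input -/

section

variable {W N : ℕ} {M : Memory} {a : ℕ → ℕ}

/-- Passes over the terms of a clause. -/
def skipTerms : Program :=
  .loop 13 12
    (.load 14 0 10 ;;
     .add 10 10 9 ;;
     .add 10 10 14 ;;
     .add 13 13 9)

/-- Records where the clauses of `f` begin. -/
def readClauses : Program :=
  .loop 11 1
    (.store 1 11 10 ;;
     .load 12 0 10 ;;
     .add 10 10 9 ;;
     .const 13 0 ;;
     skipTerms ;;
     .add 11 11 9)

/-- Records where the clauses of `g` begin and end. -/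
def readSums : Program :=
  .loop 11 2
    (.load 14 0 10 ;;
     .add 10 10 9 ;;
     .store 2 11 10 ;;
     .add 10 10 14 ;;
     .store 3 11 10 ;;
     .add 11 11 9)

/-- Computes the square root of the content of register 2, rounded up. -/
def squareRoot : Program :=
  .loop 13 2
    (.add 13 13 5 ;;
     .add 5 5 9 ;;
     .add 13 13 5)

theorem ends_skipTerms {q j : ℕ} {F : List (List ℕ)} (h9 : M.reg 9 = 1) (ha : M.arr 0 = a)
    (h10 : M.reg 10 = q) (h13 : M.reg 13 = j) (h12 : M.reg 12 = j + F.length)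
    (hF : VarsAt a q (encodeTerms F)) (hN : q + (encodeTerms F).length ≤ W)
    (hj : j + F.length ≤ W) :
    Ends W skipTerms M fun M' T => (∀ r < 10, M'.reg r = M.reg r) ∧ M'.arr = M.arr ∧
      M'.reg 11 = M.reg 11 ∧ M'.reg 10 = q + (encodeTerms F).length ∧
      T ≤ 5 * F.length + 1 := by
  induction F generalizing M q j with
  | nil => exact ends_loop_of_le (by simp [h12, h13]) (by simp [h10])
  | cons X F ih =>
    simp only [encodeTerms_cons, List.length_cons, List.length_append] at hF hN hj h12
    obtain ⟨h1, h2⟩ := hF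
    rw [varsAt_append] at h2
    refine ends_loop_of_lt (by omega) ?_
    simp [ends_seq, h9, ha, h10, h13, h1]
    refine ⟨by omega, by omega, by omega, ?_⟩
    refine Ends.mono (ih (q := q + 1 + X.length) (j := j + 1) ?_ ?_ ?_ ?_ ?_ h2.2 ?_ ?_) ?_
    · simpa
    · simpa
    · simp
    · simp
    · simp [h12]; omega
    · omega
    · omega
    rintro M' T ⟨hr, hA, h11, h10', hT⟩
    simp at hA h11
    refine ⟨fun r hr' => ?_, hA, h11, ?_, by omega⟩
    · rw [hr r hr']
      simp [show r ≠ 10 by omega, show r ≠ 13 by omega, show r ≠ 14 by omega]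
    · rw [h10']
      omega

/-- The end position is stored only after this loop. The conclusion therefore concerns every `cs`
that extends the recorded positions by that end. -/
theorem ends_readClauses {i q c : ℕ} {f : List (List (List ℕ))} (h9 : M.reg 9 = 1)
    (ha : M.arr 0 = a) (h1 : M.reg 1 = i + f.length) (h11 : M.reg 11 = i) (h10 : M.reg 10 = q)
    (hf : VarsAt a q (encodeClauses f)) (hN : q + (encodeClauses f).length ≤ N) (hNW : N ≤ W)
    (hi : i + f.length ≤ W) (hc : ∀ F ∈ f, F.length ≤ c) :
    Ends W readClauses M fun M' T => (∀ r < 10, M'.reg r = M.reg r) ∧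
      (∀ A, A ≠ 1 → M'.arr A = M.arr A) ∧ M'.reg 11 = i + f.length ∧
      M'.reg 10 = q + (encodeClauses f).length ∧ (∀ j < i, M'.arr 1 j = M.arr 1 j) ∧
      (∀ cs : ℕ → ℕ, (∀ j < i + f.length, cs j = M'.arr 1 j) →
        cs (i + f.length) = q + (encodeClauses f).length → 0 < a (q + (encodeClauses f).length) →
        q + (encodeClauses f).length < N →
          cs i = q ∧ ClausesAt a N cs (i + f.length) i f) ∧
      T ≤ (5 * c + 7) * f.length + 1 := by
  induction f generalizing M i q with
  | nil =>
    refine ends_loop_of_le (by simp [h1, h11]) (by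
      simp [h10, h11, ClausesAt]
      intro cs _ h h' h''
      exact ⟨h, by rwa [h], by omega⟩)
  | cons F f ih =>
    simp only [encodeClauses_cons, List.length_cons, List.length_append] at hf hN hi h1 ⊢
    obtain ⟨hF, hf⟩ := hf
    rw [varsAt_append] at hf
    have hFc := hc F (by simp)
    have hFl : F.length ≤ (encodeTerms F).length := by
      clear * -
      induction F with
      | nil => simp
      | cons X F ih => simp; omega
    refine ends_loop_of_lt (by omega) ?_
    simp [ends_seq, h9, h10, h11, ha, hF]
    refine ⟨by omega, ?_⟩
    refine Ends.mono (ends_skipTerms (a := a) (q := q + 1) (j := 0)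
      (F := F) ?_ ?_ ?_ ?_ ?_ hf.1 ?_ ?_) ?_
    · simpa
    · simpa
    · simp
    · simp
    · simp
    · omega
    · omega
    rintro M₁ T₁ ⟨hr₁, hA₁, h11₁, h10₁, hT₁⟩
    have e9 := hr₁ 9 (by norm_num)
    have e1 := hr₁ 1 (by norm_num)
    simp [h9, h11, h1] at e9 e1 h11₁
    simp [e9, h11₁]
    refine ⟨by omega, ?_⟩
    refine Ends.mono (ih (q := q + 1 + (encodeTerms F).length) (i := i + 1) ?_ ?_ ?_ ?_ ?_
      hf.2 ?_ ?_ fun F' hF' => hc F' (by simp [hF'])) ?_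
    · simpa
    · simpa [hA₁]
    · simp [e1]; omega
    · simp
    · simpa
    · omega
    · omega
    rintro M₂ T₂ ⟨hr₂, hA₂, h11₂, h10₂, hj₂, hcs₂, hT₂⟩
    have hmul : (5 * c + 7) * (f.length + 1) = (5 * c + 7) * f.length + (5 * c + 7) := by ring
    refine ⟨fun r hr => ?_, fun A hA => ?_, by omega, by omega, fun j hj => ?_,
      fun cs h1 h2 h3 h4 => ?_, by omega⟩
    · rw [hr₂ r hr]
      simp [show r ≠ 11 by omega, hr₁ r hr, show r ≠ 10 by omega, show r ≠ 12 by omega,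
        show r ≠ 13 by omega]
    · rw [hA₂ A hA]
      simp [hA₁, hA]
    · rw [hj₂ j (by omega)]
      simp [hA₁, hj.ne]
    · have e : q + ((encodeTerms F).length + (encodeClauses f).length + 1) =
          q + 1 + (encodeTerms F).length + (encodeClauses f).length := by omega
      have e' : i + (f.length + 1) = i + 1 + f.length := by omega
      rw [e] at h2 h3 h4
      rw [e'] at h1 h2 ⊢
      have hi' : cs i = q := by
        rw [h1 i (by omega), hj₂ i (by omega)]
        simp [hA₁]
      obtain ⟨-, h6⟩ := hcs₂ cs h1 h2 h3 h4
      refine ⟨hi', by omega, by rw [hi', hF], by omega, ?_, h6⟩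
      rw [hi']
      exact hf.1.termsAt (by omega)

theorem ends_readSums {i q : ℕ} {g : List (List ℕ)} (h9 : M.reg 9 = 1)
    (ha : M.arr 0 = a) (h2 : M.reg 2 = i + g.length) (h11 : M.reg 11 = i) (h10 : M.reg 10 = q)
    (hg : VarsAt a q (encodeTerms g)) (hN : q + (encodeTerms g).length ≤ W)
    (hi : i + g.length ≤ W) :
    Ends W readSums M fun M' T => (∀ r < 10, M'.reg r = M.reg r) ∧
      (∀ A, A ≠ 2 → A ≠ 3 → M'.arr A = M.arr A) ∧
      M'.reg 10 = q + (encodeTerms g).length ∧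
      (∀ j < i, M'.arr 2 j = M.arr 2 j ∧ M'.arr 3 j = M.arr 3 j) ∧
      (∀ j (hj : j < g.length), q ≤ M'.arr 2 (i + j) ∧
        M'.arr 3 (i + j) = M'.arr 2 (i + j) + g[j].length ∧
        M'.arr 3 (i + j) ≤ q + (encodeTerms g).length ∧
        VarsAt a (M'.arr 2 (i + j)) g[j]) ∧
      T ≤ 7 * g.length + 1 := by
  induction g generalizing M i q with
  | nil => exact ends_loop_of_le (by simp [h2, h11]) (by simp [h10])
  | cons X g ih =>
    simp only [encodeTerms_cons, List.length_cons, List.length_append] at hg hN hi h2 ⊢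
    obtain ⟨hX, hg⟩ := hg
    rw [varsAt_append] at hg
    refine ends_loop_of_lt (by omega) ?_
    simp [ends_seq, h9, h10, h11, ha, hX]
    refine ⟨by omega, by omega, by omega, ?_⟩
    refine Ends.mono (ih (q := q + 1 + X.length) (i := i + 1) ?_ ?_ ?_ ?_ ?_ hg.2 ?_ ?_) ?_
    · simpa
    · simpa
    · simp [h2]; omega
    · simp
    · simp
    · omega
    · omega
    rintro M₁ T₁ ⟨hr₁, hA₁, h10₁, hj₁, hg₁, hT₁⟩
    refine ⟨fun r hr => ?_, fun A hA hA' => ?_, ?_, fun j hj => ?_, fun j hj => ?_, by omega⟩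
    · rw [hr₁ r hr]
      simp [show r ≠ 11 by omega, show r ≠ 10 by omega, show r ≠ 14 by omega]
    · rw [hA₁ A hA hA']
      simp [hA, hA']
    · rw [h10₁]
      omega
    · obtain ⟨h, h'⟩ := hj₁ j (by omega)
      rw [h, h']
      simp [hj.ne]
    · cases j with
      | zero =>
        obtain ⟨h, h'⟩ := hj₁ i (by omega)
        simp at h h'
        simp [h, h', hg.1]
        omega
      | succ j =>
        have := hg₁ j (by omega)
        rw [show i + 1 + j = i + (j + 1) by omega] at this
        simp only [List.getElem_cons_succ]
        exact ⟨by omega, this.2.1, by omega, this.2.2.2⟩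

/-- Without multiplication, register 13 follows the square of register 5 through (L + 1)² = L² + L +
(L + 1). As long as L² < m, the new value is at most `3 * m`. -/
theorem ends_squareRoot {m : ℕ} (h2 : M.reg 2 = m) (h5 : M.reg 5 = 0) (h9 : M.reg 9 = 1)
    (h13 : M.reg 13 = 0) (hm : 3 * m ≤ W) (hm0 : 0 < m) :
    Ends W squareRoot M fun M' T => (∀ r < 10, r ≠ 5 → M'.reg r = M.reg r) ∧ M'.arr = M.arr ∧
      0 < M'.reg 5 ∧ m ≤ M'.reg 5 * M'.reg 5 ∧ (M'.reg 5 - 1) * (M'.reg 5 - 1) < m ∧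
      M'.reg 5 ≤ m ∧ T ≤ 4 * m + 1 := by
  refine ends_loop (fun B M' => (∀ r < 10, r ≠ 5 → M'.reg r = M.reg r) ∧ M'.arr = M.arr ∧
    M'.reg 13 = M'.reg 5 * M'.reg 5 ∧ (M'.reg 5 - 1) * (M'.reg 5 - 1) < m ∧
    M'.reg 5 ≤ m ∧ 4 * (m - M'.reg 5) ≤ B) (B := 4 * m) ?_ ?_ ?_
  · simp [h5, h13, hm0]
  · rintro B M₁ ⟨hr, hA, hsq, hlt, hle, hB⟩ hlt'
    have e2 := hr 2 (by norm_num) (by norm_num)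
    have e9 := hr 9 (by norm_num) (by norm_num)
    rw [e2, h2] at hlt'
    have hL : M₁.reg 5 ≤ M₁.reg 5 * M₁.reg 5 := Nat.le_mul_self _
    simp [ends_seq, e9, h9]
    refine ⟨by omega, by omega, by omega, 4 * (m - (M₁.reg 5 + 1)), ⟨fun r hr' hr5 => ?_, hA, ?_,
      by omega, by omega, le_rfl⟩, by omega⟩
    · simp [hr5, show r ≠ 13 by omega, hr r hr' hr5]
    · rw [hsq]; ring
  · rintro B' M' T ⟨hr, hA, hsq, hlt, hle, hB⟩ hle' hT
    have e2 := hr 2 (by norm_num) (by norm_num)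
    rw [e2, h2, hsq] at hle'
    refine ⟨hr, hA, ?_, hle', hlt, hle, by omega⟩
    by_contra! h0
    simp [show M'.reg 5 = 0 by omega] at hle'
    omega

end

/-! ### The whole program and its running time -/

/-- The whole program. -/
def testMonomials : Program :=
  .const 9 1 ;;
  .load 1 0 9 ;;
  .const 10 2 ;;
  .const 11 0 ;;
  readClauses ;;
  .store 1 11 10 ;;
  .load 2 0 10 ;;
  .add 10 10 9 ;;
  .add 4 10 8 ;;
  .const 11 0 ;;
  readSums ;;
  .add 3 10 8 ;;
  .const 13 0 ;;
  squareRoot ;;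
  explore

/-- Identifies the size of the incidence structure with the length of the encoding of the second
factor. -/
theorem sum_length_add_one (g : List (List ℕ)) :
    ∑ u ∈ Finset.range g.length, ((g.getD u []).length + 1) = (encodeTerms g).length := by
  induction g with
  | nil => simp
  | cons X g ih =>
    rw [List.length_cons, Finset.sum_range_succ']
    simp only [List.getD_cons_succ, ih]
    simp
    omega

theorem ends_testMonomials {n k c t m s : ℕ} {f : PiSigmaPi n} {g : PiSigma n} (hm : 1 ≤ m)
    (hf : IsPiSigmaPi k c t f) (hg : IsPiSigma m s g) :
    Ends (4 * inputSize f g) testMonomials (initialMemory (encodeInput f g)) fun M T =>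
      (M.reg 0 = 1 ↔ ∃ d ∈ sumProductExpansion (f ++ g.toPiSigmaPi), IsMultilinear d) ∧
      ∃ L, (L - 1) * (L - 1) < m ∧
        T ≤ exploreCost (14 * t + 50) (200 * (L * (m * (s + 1))) + 10) (indices f) +
          (5 * c + 7) * k + 11 * m + 40 := by
  set f' := indices f with hf'
  set g' := g.map fun X => X.map Fin.val with hg'
  set w := encodeInput f g with hw
  have hwe : w = n :: f'.length :: (encodeClauses f' ++ g'.length :: encodeTerms g') := by
    rw [hw, encodeInput_eq, List.length_map]
  set N := w.length with hN
  have hNe : N = (encodeClauses f').length + (encodeTerms g').length + 3 := by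
    rw [hN, hwe]; simp; omega
  -- The factor 4 leaves room for the square root computation, which reaches `3 * m`, and for
  -- counters just beyond the input length.
  have hW : 4 * N ≤ 4 * inputSize f g :=
    Nat.mul_le_mul_left 4 (Nat.le_add_right _ _)
  generalize 4 * inputSize f g = W at hW
  set a : ℕ → ℕ := fun i => w.getD i 0 with ha
  have hall : VarsAt a 0 w := varsAt_getD w []
  rw [hwe] at hall
  obtain ⟨-, hk, hall⟩ := hall
  rw [varsAt_append] at hall
  obtain ⟨hfa, hma, hga⟩ := hall
  simp only [zero_add, Nat.reduceAdd] at hk hfa hma hga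
  have hfl : f'.length = k := by rw [hf', indices, List.length_map, hf.1]
  have hgl : g'.length = m := by rw [hg', List.length_map, hg.1]
  have hmle : m ≤ (encodeTerms g').length := by
    rw [← sum_length_add_one, ← hgl]
    have : ∑ u ∈ Finset.range g'.length, 1 ≤ ∑ u ∈ Finset.range g'.length,
      ((g'.getD u []).length + 1) :=
      Finset.sum_le_sum fun _ _ => by omega
    simpa using this
  have hkle : k ≤ (encodeClauses f').length := by
    rw [← hfl]
    clear * -
    induction f' with
    | nil => simp
    | cons F f ih => simp; omega
  have hfc : ∀ F ∈ f', F.length ≤ c := by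
    intro F hF
    obtain ⟨F, hF', rfl⟩ := List.mem_map.1 hF
    simpa using (hf.2 F hF').2.1
  have hft : ∀ F ∈ f', ∀ X ∈ F, X.length ≤ t := by
    intro F hF X hX
    obtain ⟨F, hF', rfl⟩ := List.mem_map.1 hF
    obtain ⟨X, hX', rfl⟩ := List.mem_map.1 hX
    simpa using (hf.2 F hF').2.2 X hX'
  have hgs : (encodeTerms g').length ≤ m * (s + 1) := by
    rw [← sum_length_add_one, hgl]
    refine (Finset.sum_le_card_nsmul _ _ (s + 1) fun u hu => ?_).trans (by simp)
    have hu : u < g'.length := by rw [hgl]; exact Finset.mem_range.1 hu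
    rw [List.getD_eq_getElem _ _ hu]
    simp only [hg', List.getElem_map, List.length_map]
    have := (hg.2 _ (List.getElem_mem (by simpa [hg'] using hu : u < g.length))).2
    omega
  have harr0 : (initialMemory w).arr 0 = a := rfl
  have hk' : a 1 = k := by rw [hk, hfl]
  simp only [testMonomials, ends_seq, ends_const]
  simp [harr0, hk']
  refine ⟨by omega, by omega, ?_⟩
  refine Ends.mono (ends_readClauses (i := 0) (q := 2) (f := f') (N := N)
    (a := a) ?_ ?_ ?_ ?_ ?_ hfa ?_ ?_ ?_ hfc) ?_
  · simp
  · simpa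
  · simp [hfl]
  · simp
  · simp
  · omega
  · omega
  · omega
  rintro M₁ T₁ ⟨hr₁, hA₁, h11₁, h10₁, -, hcs₁, hT₁⟩
  have e0 := hr₁ 0 (by norm_num)
  have e1 := hr₁ 1 (by norm_num)
  have e5 := hr₁ 5 (by norm_num)
  have e8 := hr₁ 8 (by norm_num)
  have e9 := hr₁ 9 (by norm_num)
  have a0 := hA₁ 0 (by norm_num)
  have a6 := hA₁ 6 (by norm_num)
  simp [initialMemory] at e0 e1 e5 e8 e9 a6
  simp [harr0] at a0
  rw [hgl] at hma
  simp [h11₁, h10₁, a0, e8, e9, hma]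
  refine ⟨by omega, ?_⟩
  refine Ends.mono (ends_readSums (i := 0) (q := 2 + (encodeClauses f').length + 1) (g := g')
    (a := a) ?_ ?_ ?_ ?_ ?_ hga ?_ ?_) ?_
  · simpa
  · simpa
  · simp [hgl]
  · simp
  · simp
  · omega
  · omega
  rintro M₂ T₂ ⟨hr₂, hA₂, h10₂, -, hg₂, hT₂⟩
  have f0 := hr₂ 0 (by norm_num)
  have f1 := hr₂ 1 (by norm_num)
  have f2 := hr₂ 2 (by norm_num)
  have f4 := hr₂ 4 (by norm_num)
  have f5 := hr₂ 5 (by norm_num)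
  have f8 := hr₂ 8 (by norm_num)
  have f9 := hr₂ 9 (by norm_num)
  have b0 := hA₂ 0 (by norm_num) (by norm_num)
  have b1 := hA₂ 1 (by norm_num) (by norm_num)
  have b6 := hA₂ 6 (by norm_num) (by norm_num)
  simp [e0, e1, e5, e8, e9, a0, a6] at f0 f1 f2 f4 f5 f8 f9 b0 b1 b6
  have hend : 2 + (encodeClauses f').length + 1 + (encodeTerms g').length = N := by omega
  rw [hend] at h10₂
  simp [h10₂, f8]
  refine ⟨by omega, ?_⟩
  refine Ends.mono (ends_squareRoot (m := m) ?_ ?_ ?_ ?_ ?_ hm) ?_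
  · simpa
  · simpa
  · simpa
  · simp
  · omega
  rintro M₃ T₃ ⟨hr₃, hA₃, hL₀, hL₁, hL₂, hL₃, hT₃⟩
  have g0 := hr₃ 0 (by norm_num) (by norm_num)
  have g1 := hr₃ 1 (by norm_num) (by norm_num)
  have g2 := hr₃ 2 (by norm_num) (by norm_num)
  have g3 := hr₃ 3 (by norm_num) (by norm_num)
  have g4 := hr₃ 4 (by norm_num) (by norm_num)
  have g8 := hr₃ 8 (by norm_num) (by norm_num)
  have g9 := hr₃ 9 (by norm_num) (by norm_num)
  simp [f0, f1, f2, f4, f8, f9] at g0 g1 g2 g3 g4 g8 g9 hA₃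
  rw [← hA₃] at b0 b1 b6 hg₂
  simp only [zero_add] at hg₂ hcs₁ h11₁
  obtain ⟨L, hLe⟩ : ∃ L, M₃.reg 5 = L := ⟨_, rfl⟩
  rw [hLe] at hL₀ hL₁ hL₂ hL₃
  set G : Incidence := ⟨m, M₃.arr 2, M₃.arr 3, a, fun _ => 0⟩ with hG
  have hgj : ∀ u (hu : u < m), 2 + (encodeClauses f').length + 1 ≤ M₃.arr 2 u ∧
      M₃.arr 3 u = M₃.arr 2 u + (g'[u]'(by omega)).length ∧ M₃.arr 3 u ≤ N ∧
      VarsAt a (M₃.arr 2 u) (g'[u]'(by omega)) := fun u hu => by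
    rw [← hend]; exact hg₂ u (by omega)
  have hsize : G.size = (encodeTerms g').length := by
    rw [← sum_length_add_one, hgl]
    refine Finset.sum_congr rfl fun u hu => ?_
    have hu : u < m := Finset.mem_range.1 hu
    rw [List.getD_eq_getElem _ _ (by omega)]
    have := (hgj u hu).2.1
    simp only [hG]
    omega
  have hrep : Represents G g := by
    refine ⟨hg.1.symm, fun u hu v => ?_⟩
    have hu' : u < m := by rw [← hg.1]; exact hu
    obtain ⟨-, h2, -, h4⟩ := hgj u hu'
    have : g[u].map Fin.val = g'[u]'(by omega) := by simp [hg']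
    rw [this, ← h4.mem_iff, ← h2]
    rfl
  have henv : Environment W G L N (2 + (encodeClauses f').length + 1) k (M₃.arr 1) M₃ :=
    { setting :=
        { var_eq := b0
          st_eq := rfl
          en_eq := rfl
          used_eq := rfl
          m_eq := g2
          N_eq := g3
          s_eq := g4
          L_eq := hLe
          zero := g8
          one := g9
          L_pos := hL₀
          L_lt := by omega
          N_le := by omega
          m_lt := by simp only [hG]; omega
          s_le := by omega
          size := by
            have : N - (2 + (encodeClauses f').length + 1) ≤ G.size := by omega
            exact this
          le_st := fun u hu => (hgj u hu).1
          st_le := fun u hu => by have := (hgj u hu).2.1; simp only [hG]; omega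
          en_le := fun u hu => (hgj u hu).2.2.1 }
      k_eq := g1
      cs_eq := rfl
      k_lt := by omega
      N_lt := by omega
      m_le := hL₁
      m_pos := hm }
  have hclauses : ClausesAt G.var N (M₃.arr 1) k 0 f' := by
    have := (hcs₁ (M₃.arr 1) ?_ ?_ ?_ ?_).2
    · rwa [hfl] at this
    · intro j hj
      simp [b1, hj.ne]
    · simp [b1]
    -- The word after the clauses of `f` is `m`; its positivity makes the leaves of the exploration
    -- be entered.
    · rw [hma]; exact hm
    · omega
  refine (ends_explore (b := 14 * t + 50) le_rfl hclauses hft henv g0 fun v => by rw [b6]).mono ?_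
  rintro M₄ T₄ ⟨hres, hT₄⟩
  refine ⟨?_, L, hL₂, ?_⟩
  · rw [hres, choosable_iff hrep f (e := 0) (fun i => by simp) fun x => by simp]
    simp
  · have hmono : exploreCost (14 * t + 50) (200 * (L * G.size) + 10) f' ≤
        exploreCost (14 * t + 50) (200 * (L * (m * (s + 1))) + 10) f' := by
      have : 200 * (L * G.size) + 10 ≤ 200 * (L * (m * (s + 1))) + 10 := by
        rw [hsize]; gcongr
      clear * - this
      induction f' with
      | nil => exact this
      | cons F f ih => exact Nat.mul_le_mul_left _ (Nat.add_le_add_left ih _)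
    rw [hfl] at hT₁
    rw [hgl] at hT₂
    omega

/-- Adding `2 * b` turns the recursion x ↦ c (b + x) into a multiplication by at most `c`, because
2b ≤ cb. For `c = 1` the cost of the inner nodes would grow linearly in `k`. -/
theorem exploreCost_le {b l c : ℕ} (hc : 2 ≤ c) {f : List (List (List ℕ))}
    (hf : ∀ F ∈ f, F.length ≤ c) :
    exploreCost b l f + 2 * b ≤ c ^ f.length * (l + 2 * b) := by
  induction f with
  | nil => simp [exploreCost]
  | cons F f ih =>
    have ih := ih fun F' hF' => hf F' (List.mem_cons_of_mem _ hF')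
    have hF := hf F (by simp)
    rw [exploreCost, List.length_cons, pow_succ]
    calc F.length * (b + exploreCost b l f) + 2 * b
        ≤ c * (b + exploreCost b l f) + c * b := by gcongr
      _ = c * (exploreCost b l f + 2 * b) := by ring
      _ ≤ c * (c ^ f.length * (l + 2 * b)) := by gcongr
      _ = c ^ f.length * c * (l + 2 * b) := by ring

/-- Absorbs the time for reading the clauses of the first factor into `c ^ k`. -/
theorem mul_le_pow {k c : ℕ} (hk : 1 ≤ k) (hc : 2 ≤ c) : k * c ≤ c ^ k := by
  obtain ⟨j, rfl⟩ := Nat.exists_eq_add_of_le' hk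
  have h : j < c ^ j := Nat.lt_pow_self (by omega)
  rw [pow_succ]
  gcongr
  omega

theorem time_le {n k c t m s L T : ℕ} {f : List (List (List ℕ))} (hk : 1 ≤ k) (hc : 2 ≤ c)
    (ht : 1 ≤ t) (hm : 1 ≤ m) (hs : 1 ≤ s) (hfk : f.length = k) (hf : ∀ F ∈ f, F.length ≤ c)
    (hL : (L - 1) * (L - 1) < m)
    (hT : T ≤ exploreCost (14 * t + 50) (200 * (L * (m * (s + 1))) + 10) f +
      (5 * c + 7) * k + 11 * m + 40) :
    (T : ℝ) ≤ (2000 : ℕ) * ((t : ℝ) * (c : ℝ) ^ k * (m : ℝ) * (s : ℝ) * √((m : ℝ) + (n : ℝ))) := by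
  set r := √((m : ℝ) + (n : ℝ)) with hr
  have hm' : (1 : ℝ) ≤ m := by exact_mod_cast hm
  have ht' : (1 : ℝ) ≤ t := by exact_mod_cast ht
  have hs' : (1 : ℝ) ≤ s := by exact_mod_cast hs
  have hr1 : 1 ≤ r := Real.one_le_sqrt.2 (by linarith [Nat.cast_nonneg (α := ℝ) n])
  -- `L - 1` is below √m, hence at most `r`, and the rounding costs at most `1 ≤ r`.
  have hLr : (L : ℝ) ≤ 2 * r := by
    rcases Nat.eq_zero_or_pos L with rfl | hL0
    · simp; linarith
    · have h1 : ((L - 1 : ℕ) : ℝ) ≤ r := by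
        refine Real.le_sqrt_of_sq_le ?_
        have : (((L - 1) * (L - 1) : ℕ) : ℝ) ≤ m := by exact_mod_cast hL.le
        push_cast at this
        nlinarith [Nat.cast_nonneg (α := ℝ) n]
      rw [Nat.cast_sub hL0] at h1
      push_cast at h1
      linarith
  have hpow : (1 : ℝ) ≤ (c : ℝ) ^ k := one_le_pow₀ (by exact_mod_cast (by omega : 1 ≤ c))
  set E := (c : ℝ) ^ k with hE
  have hX1 : 1 ≤ t * (m * s * r) := by
    have : 1 ≤ m * s * r :=
      one_le_mul_of_one_le_of_one_le (one_le_mul_of_one_le_of_one_le hm' hs') hr1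
    exact one_le_mul_of_one_le_of_one_le ht' this
  set Y := (m : ℝ) * s * r with hY
  have hY1 : 1 ≤ Y := one_le_mul_of_one_le_of_one_le (one_le_mul_of_one_le_of_one_le hm' hs') hr1
  have hYt : Y ≤ t * Y := le_mul_of_one_le_left (by linarith) ht'
  have htY : (t : ℝ) ≤ t * Y := le_mul_of_one_le_right (by linarith) hY1
  have hmY : (m : ℝ) ≤ Y := by
    rw [hY, mul_assoc]
    exact le_mul_of_one_le_right (by linarith) (one_le_mul_of_one_le_of_one_le hs' hr1)
  have hleaf : (L : ℝ) * (m * (s + 1)) ≤ 4 * Y := by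
    calc (L : ℝ) * (m * (s + 1)) ≤ 2 * r * (m * (s + s)) := by gcongr
      _ = 4 * Y := by rw [hY]; ring
  have hcost := exploreCost_le (b := 14 * t + 50) (l := 200 * (L * (m * (s + 1))) + 10) hc hf
  have hread : (5 * c + 7) * k ≤ 12 * c ^ k := by
    have h := mul_le_pow hk hc
    have : k ≤ k * c := Nat.le_mul_of_pos_right _ (by omega)
    calc (5 * c + 7) * k = 5 * (k * c) + 7 * k := by ring
      _ ≤ 12 * c ^ k := by omega
  rw [hfk] at hcost
  have hT' : T ≤ c ^ k * (200 * (L * (m * (s + 1))) + 10 + 2 * (14 * t + 50)) + 12 * c ^ k +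
      11 * m + 40 := by omega
  have hT'' : (T : ℝ) ≤ E * (200 * (L * (m * (s + 1))) + 10 + 2 * (14 * t + 50)) + 12 * E +
      11 * m + 40 := by
    rw [hE]; exact_mod_cast hT'
  have hE1 : (t : ℝ) * Y ≤ E * (t * Y) := le_mul_of_one_le_left (by linarith) hpow
  have hE2 : E ≤ E * (t * Y) := le_mul_of_one_le_right (by linarith) hX1
  -- Here 938 = 200 · 4 + 10 + 28 + 100. With the remaining 12 + 11 + 40 the total stays below 2000.
  have hin : 200 * ((L : ℝ) * (m * (s + 1))) + 10 + 2 * (14 * t + 50) ≤ 938 * (t * Y) := by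
    linarith
  have hin' := mul_le_mul_of_nonneg_left hin (by linarith : 0 ≤ E)
  have hfin : (T : ℝ) ≤ 2000 * (E * (t * Y)) := by linarith
  calc (T : ℝ) ≤ 2000 * (E * (t * Y)) := hfin
    _ = (2000 : ℕ) * ((t : ℝ) * E * m * s * r) := by rw [hY]; push_cast; ring

end MonomialTesting

theorem mainTheorem7 :
    ∃ (P : Program) (C D : ℕ), ∀ (n k c t m s : ℕ) (f : PiSigmaPi n) (g : PiSigma n),
      1 ≤ k → 2 ≤ c → 1 ≤ t → 1 ≤ m → 1 ≤ s →
      IsPiSigmaPi k c t f → IsPiSigma m s g →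
      ∃ (M : Memory) (T : ℕ),
        Run (D * inputSize f g) P (initialMemory (encodeInput f g)) M T ∧
        (T : ℝ) ≤ (C : ℝ) * ((t : ℝ) * (c : ℝ) ^ k * (m : ℝ) * (s : ℝ) * √((m : ℝ) + (n : ℝ))) ∧
        (M.reg 0 = 1 ↔ ∃ d ∈ sumProductExpansion (f ++ g.toPiSigmaPi), IsMultilinear d) ∧
        (M.reg 0 = 1 ↔
          ∃ d ∈ (f.toPoly ℤ * g.toPiSigmaPi.toPoly ℤ).support, IsMultilinear d) := by
  refine ⟨testMonomials, 2000, 4, fun n k c t m s f g hk hc ht hm hs hf hg => ?_⟩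
  obtain ⟨M, T, hrun, hres, L, hL, hT⟩ := ends_testMonomials hm hf hg
  refine ⟨M, T, hrun, ?_, hres, ?_⟩
  · refine time_le hk hc ht hm hs (by simp [indices, hf.1]) (fun F hF => ?_) hL hT
    obtain ⟨F, hF', rfl⟩ := List.mem_map.1 hF
    simpa using (hf.2 F hF').2.1
  · simp only [hres, ← toPoly_append, mem_support_iff]
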